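/- A Gauss diagram with a base point is an oriented circle with a base point and finitely many chords with distinct end points away from the base point, each carrying an arrow (from the upper to the lower branch) and a sign (the local writhe). A long virtual knot $K$ is an equivalence class of such diagrams up to the Reidemeister moves (in all orientations) away from the base point, and its elements are the diagrams of $K$. Starting from the base point, each chord has a first and a second end. For a diagram $D$, let $p(D)$ be the chord diagram with base point obtained by replacing the arrow and sign of each chord by a label: $a$ if the chord is positive and its first end is the upper one, or if it is negative and its first end is the lower one; $b$ in the two other cases. So $p(D)$ is a diagram of an open flat virtual knot. Let $i$ replace the label $a$ by the sign $+$ and $b$ by $-$, so that $i(p(D))$ is a diagram of a long pseudolink (a chord diagram with base point, with signs and without arrows). For a long pseudolink diagram $P$ let $$V_P(t)=(-A^3)^{-w(P)}\sum_S A^{\sigma(S)}(-A^2-A^{-2})^{|S|-1}\Big|_{A=t^{-1/4}}$$ be its Jones polynomial. Here $w(P)$ is the sum of the signs of the chords; a state $S$ chooses a positive or negative marker for every chord; $\sigma(S)$ is the number of positive minus the number of negative markers; and $|S|$ is the number of circles obtained by smoothing all chords, where a chord is smoothed according to the orientation if its marker equals its sign, and against the orientation otherwise. **Theorem.** Let $D$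 be a diagram of an arbitrary long virtual knot $K$. Then $V_{i(p(D))}$ is an invariant of the long virtual knot $K$: if $D$ and $D'$ are diagrams of $K$, then $V_{i(p(D))}=V_{i(p(D'))}$. -/

import Mathlib

open scoped LaurentPolynomial

/-- One passage of a long oriented curve through a crossing: the label of the crossing (a chord of
the Gauss diagram), whether the passage is the upper one (the tail of the arrow, `isOver = true`) or
the lower one (the head of the arrow), and the sign (local writhe) of the crossing. -/
structure GaussLetter where
  chord : ℕ
  isOver : Bool
  sign : ℤˣ

/-- Rename the chord of a letter. -/
def GaussLetter.relabel (f : ℕ → ℕ) (x : GaussLetter) : GaussLetter := ⟨f x.chord, x.isOver, x.sign⟩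

/-- A Gauss diagram with a base point, with an arrow and a sign on every chord. Cutting the
oriented circle at the base point, it is the sequence of the ends of its chords. Every chord has
exactly two ends, a tail (over) and a head (under), with the same sign. -/
structure LongGaussDiagram where
  word : List GaussLetter
  count_two : ∀ x ∈ word, (word.map GaussLetter.chord).count x.chord = 2
  compatible : word.Pairwise fun x y => x.chord = y.chord → x.isOver ≠ y.isOver ∧ x.sign = y.sign

/-- The two consecutive chord ends on each of the three strands (`0` top, `1` middle, `2` bottom)
of a triangle in a third Reidemeister move. The crossings top-middle, top-bottom, middle-bottom
have labels `c₀₁, c₀₂, c₁₂` and signs `e₀₁, e₀₂, e₁₂`. For three oriented straight lines in general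
position, the order in which each line meets the two others is determined by the signs and by the
orientation `δ` of the triangle as below; the move replaces `δ` by `-δ`. All eight triples of signs
occur, and they are the eight oriented third Reidemeister moves. -/
def omegaThreeStrand (c₀₁ c₀₂ c₁₂ : ℕ) (e₀₁ e₀₂ e₁₂ δ : ℤˣ) : Fin 3 → List GaussLetter :=
  ![if e₀₁ * e₀₂ = δ then [⟨c₀₁, true, e₀₁⟩, ⟨c₀₂, true, e₀₂⟩]
      else [⟨c₀₂, true, e₀₂⟩, ⟨c₀₁, true, e₀₁⟩],
    if e₀₁ * e₁₂ = δ then [⟨c₀₁, false, e₀₁⟩, ⟨c₁₂, true, e₁₂⟩]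
      else [⟨c₁₂, true, e₁₂⟩, ⟨c₀₁, false, e₀₁⟩],
    if e₀₂ * e₁₂ = δ then [⟨c₀₂, false, e₀₂⟩, ⟨c₁₂, false, e₁₂⟩]
      else [⟨c₁₂, false, e₁₂⟩, ⟨c₀₂, false, e₀₂⟩]]

/-- The elementary moves of Gauss diagrams with a base point: renaming of the chords, and all
oriented Reidemeister moves away from the base point. Since both sides are Gauss diagrams, the
chords created by a move are automatically new and distinct. -/
inductive LongGaussDiagram.Move : LongGaussDiagram → LongGaussDiagram → Prop
  /-- The names of the chords are immaterial. -/
  | relabel (D D' : LongGaussDiagram) (f : Equiv.Perm ℕ)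
      (h : D'.word = D.word.map (GaussLetter.relabel f)) : Move D D'
  /-- First Reidemeister move: an isolated chord with any arrow and sign. -/
  | omegaOne (D D' : LongGaussDiagram) (x y : List GaussLetter) (c : ℕ) (o : Bool) (s : ℤˣ)
      (h : D.word = x ++ y)
      (h' : D'.word = x ++ [⟨c, o, s⟩, ⟨c, !o, s⟩] ++ y) : Move D D'
  /-- Second Reidemeister move, the two strands having the same direction. -/
  | omegaTwoDirect (D D' : LongGaussDiagram) (x y z : List GaussLetter) (c d : ℕ) (o : Bool)
      (s : ℤˣ) (h : D.word = x ++ y ++ z)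
      (h' : D'.word = x ++ [⟨c, o, s⟩, ⟨d, o, -s⟩] ++ y ++ [⟨c, !o, s⟩, ⟨d, !o, -s⟩] ++ z) :
      Move D D'
  /-- Second Reidemeister move, the two strands having opposite directions. -/
  | omegaTwoOpposite (D D' : LongGaussDiagram) (x y z : List GaussLetter) (c d : ℕ) (o : Bool)
      (s : ℤˣ) (h : D.word = x ++ y ++ z)
      (h' : D'.word = x ++ [⟨c, o, s⟩, ⟨d, o, -s⟩] ++ y ++ [⟨d, !o, -s⟩, ⟨c, !o, s⟩] ++ z) :
      Move D D'
  /-- Third Reidemeister move; `π` is the order in which the curve runs through the strands. -/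
  | omegaThree (D D' : LongGaussDiagram) (x y z v : List GaussLetter) (c₀₁ c₀₂ c₁₂ : ℕ)
      (e₀₁ e₀₂ e₁₂ δ : ℤˣ) (π : Equiv.Perm (Fin 3))
      (h : D.word = x ++ omegaThreeStrand c₀₁ c₀₂ c₁₂ e₀₁ e₀₂ e₁₂ δ (π 0) ++
        y ++ omegaThreeStrand c₀₁ c₀₂ c₁₂ e₀₁ e₀₂ e₁₂ δ (π 1) ++
        z ++ omegaThreeStrand c₀₁ c₀₂ c₁₂ e₀₁ e₀₂ e₁₂ δ (π 2) ++ v)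
      (h' : D'.word = x ++ omegaThreeStrand c₀₁ c₀₂ c₁₂ e₀₁ e₀₂ e₁₂ (-δ) (π 0) ++
        y ++ omegaThreeStrand c₀₁ c₀₂ c₁₂ e₀₁ e₀₂ e₁₂ (-δ) (π 1) ++
        z ++ omegaThreeStrand c₀₁ c₀₂ c₁₂ e₀₁ e₀₂ e₁₂ (-δ) (π 2) ++ v) : Move D D'

/-- A long virtual knot: a class of Gauss diagrams with a base point under the equivalence relation
generated by the moves (`Quot` divides by the generated equivalence relation). -/
def LongVirtualKnot : Type := Quot LongGaussDiagram.Move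

/-- `D` is a diagram of the long virtual knot `K`. -/
def LongGaussDiagram.IsDiagramOf (D : LongGaussDiagram) (K : LongVirtualKnot) : Prop :=
  Quot.mk LongGaussDiagram.Move D = K

/-- A chord diagram with a base point whose chords have no direction and are labelled by elements
of `α`, as the sequence of the ends of its chords starting from the base point. -/
structure LongChordDiagram (α : Type) where
  word : List (ℕ × α)
  count_two : ∀ x ∈ word, (word.map Prod.fst).count x.1 = 2
  label_eq : ∀ x ∈ word, ∀ y ∈ word, x.1 = y.1 → x.2 = y.2

/-- The labels of the double points of an open flat virtual knot diagram. -/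
inductive FlatLabel
  | a
  | b

/-- A diagram of an open flat virtual knot: the chords are labelled by `a` and `b`. -/
abbrev OpenFlatDiagram : Type := LongChordDiagram FlatLabel

/-- A diagram of a long pseudolink: the chords are labelled by signs. -/
abbrev LongPseudolinkDiagram : Type := LongChordDiagram ℤˣ

/-- Whether the passage through the chord `c` that comes first from the base point is the upper
one. -/
def LongGaussDiagram.firstIsOver (D : LongGaussDiagram) (c : ℕ) : Bool :=
  match D.word.find? (fun x => x.chord = c) with
  | some x => x.isOver
  | none => false

/-- The label of the chord of the letter `x` in the underlying flat diagram: `a` if the chord is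
first passed over and is positive, or first passed under and is negative; `b` otherwise. -/
def LongGaussDiagram.flatLabel (D : LongGaussDiagram) (x : GaussLetter) : FlatLabel :=
  if (D.firstIsOver x.chord = true ↔ x.sign = 1) then FlatLabel.a else FlatLabel.b

/-- The projection `p` to diagrams of open flat virtual knots. -/
def LongGaussDiagram.p (D : LongGaussDiagram) : OpenFlatDiagram where
  word := D.word.map fun x => (x.chord, D.flatLabel x)
  count_two := by
    intro x hx
    obtain ⟨y, hy, rfl⟩ := List.mem_map.1 hx
    simpa [Function.comp_def] using D.count_two y hy
  label_eq := by
    intro x hx y hy hxy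
    obtain ⟨u, hu, rfl⟩ := List.mem_map.1 hx
    obtain ⟨v, hv, rfl⟩ := List.mem_map.1 hy
    have : Std.Symm fun x y : GaussLetter => x.chord = y.chord → x.sign = y.sign :=
      ⟨fun _ _ h e => (h e.symm).symm⟩
    have hs : u.chord = v.chord → u.sign = v.sign :=
      List.Pairwise.forall_of_forall (R := fun x y => x.chord = y.chord → x.sign = y.sign)
        (fun _ _ _ => rfl) (D.compatible.imp fun h e => (h e).2) hu hv
    have hc : u.chord = v.chord := hxy
    simp only [LongGaussDiagram.flatLabel, hc, hs hc]

/-- The sign that replaces a label: `+` for `a` and `-` for `b`. -/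
def FlatLabel.toSign : FlatLabel → ℤˣ
  | FlatLabel.a => 1
  | FlatLabel.b => -1

/-- The map `i` from diagrams of open flat virtual knots to diagrams of long pseudolinks. -/
def OpenFlatDiagram.i (F : OpenFlatDiagram) : LongPseudolinkDiagram where
  word := F.word.map fun x => (x.1, x.2.toSign)
  count_two := by
    intro x hx
    obtain ⟨y, hy, rfl⟩ := List.mem_map.1 hx
    simpa [Function.comp_def] using F.count_two y hy
  label_eq := by
    intro x hx y hy hxy
    obtain ⟨u, hu, rfl⟩ := List.mem_map.1 hx
    obtain ⟨v, hv, rfl⟩ := List.mem_map.1 hy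
    exact congrArg FlatLabel.toSign (F.label_eq u hu v hv hxy)

namespace LongPseudolinkDiagram

/-- The set of chords, each with its sign. -/
def chords (P : LongPseudolinkDiagram) : Finset (ℕ × ℤˣ) := P.word.toFinset

/-- The writhe: the number of positive chords minus the number of negative chords. -/
def writhe (P : LongPseudolinkDiagram) : ℤ := ∑ c ∈ P.chords, (c.2 : ℤ)

/-- How a state joins the arcs of the curve. The chord ends, numbered from the base point, cut the
long curve into arcs; arc `j.castSucc` runs into the chord end `j` and arc `j.succ` runs out of it.
The state is given by the set `S` of the chords with a positive marker. The smoothing of a chord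
respects the orientation of the curve if and only if its marker (`+` for `S`, `-` otherwise) agrees
with its sign. The first and the last arc are joined by closing the long curve. -/
inductive Joined (P : LongPseudolinkDiagram) (S : Finset (ℕ × ℤˣ)) :
    Fin (P.word.length + 1) → Fin (P.word.length + 1) → Prop
  | closure : Joined P S 0 (Fin.last _)
  | oriented (j k : Fin P.word.length) (hne : j ≠ k) (heq : P.word.get j = P.word.get k)
      (h : P.word.get j ∈ S ↔ (P.word.get j).2 = 1) : Joined P S j.castSucc k.succ
  | unorientedIn (j k : Fin P.word.length) (hne : j ≠ k) (heq : P.word.get j = P.word.get k)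
      (h : ¬(P.word.get j ∈ S ↔ (P.word.get j).2 = 1)) : Joined P S j.castSucc k.castSucc
  | unorientedOut (j k : Fin P.word.length) (hne : j ≠ k) (heq : P.word.get j = P.word.get k)
      (h : ¬(P.word.get j ∈ S ↔ (P.word.get j).2 = 1)) : Joined P S j.succ k.succ

/-- The number of circles of a state. -/
noncomputable def circles (P : LongPseudolinkDiagram) (S : Finset (ℕ × ℤˣ)) : ℕ :=
  Nat.card (Quot (P.Joined S))

/-- The power `A ^ k`, where `A = t ^ (-1/4)`. Laurent polynomials are written in the variable
`LaurentPolynomial.T 1 = t ^ (1/4)`. -/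
noncomputable def powA (k : ℤ) : ℤ[T;T⁻¹] := LaurentPolynomial.T (-k)

/-- The Kauffman bracket: the sum over all states `S` of
`A ^ σ(S) * (- A ^ 2 - A ^ (-2)) ^ (|S| - 1)`, where `σ(S)` is the number of positive markers minus
the number of negative markers and `|S| ≥ 1` is the number of circles. -/
noncomputable def bracket (P : LongPseudolinkDiagram) : ℤ[T;T⁻¹] :=
  ∑ S ∈ P.chords.powerset,
    powA ((S.card : ℤ) - ((P.chords \ S).card : ℤ)) *
      (-powA 2 - powA (-2)) ^ (P.circles S - 1)

/-- The Jones polynomial `V(t) = (- A ^ 3) ^ (- w) * bracket` at `A = t ^ (-1/4)`, where `w` is the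
writhe. -/
noncomputable def jones (P : LongPseudolinkDiagram) : ℤ[T;T⁻¹] :=
  ((P.writhe.negOnePow : ℤˣ) : ℤ) • (powA (-3 * P.writhe) * P.bracket)

end LongPseudolinkDiagram

/-!
The label of a chord in `i (p D)` is its sign if it is first passed over, and the opposite of its
sign otherwise. This is the sign that the chord has in the descending diagram of `D`, the diagram in
which all crossings are changed so that they are first passed over. A Reidemeister move on `D` is a
Reidemeister move on the descending diagram: for the third move, the heights of the three strands
are just rearranged into the order in which the curve runs through them (`exists_flat_triangle`).
Since the Jones polynomial in terms of signed chords forgets the arrows, it remains to show the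
invariance of the Kauffman bracket under the Reidemeister moves on words of signed chords.

A state of a word is encoded as an equivalence relation on the arcs, which are numbered by `ℕ`, as
the supremum of one relation for each chord; the circles are its classes (`circles_eq`). To avoid
the exponent `|S| - 1`, the bracket is multiplied by the value `d = - A ^ 2 - A ^ (-2)` of a circle,
which is not a zero divisor (`circleValue_mul_bracket`). Splitting off the chords of a move
(`stateSum_insert`) turns the state sum of the remaining chords into a functional on the relations
that are generated near the move. All that is needed about this functional is that joining an
isolated arc to another one divides it by `d` (`Eliminates`); the local pictures are then computed
with the usual skein arguments (`kink_eval`, `bigon_eval`, `triangle_eval`). A third move reverses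
the order of the crossings on each of the three strands, that is, it reads all strands backwards,
and the value of the triangle is symmetric under this (`triangleValue_reverse`). All oriented
versions of this move reduce to one, because reading a strand backwards changes the signs of its
crossings.

For the first and second move the two words have different arcs. There the new arcs of the longer
word are collapsed along a surjection, which preserves the number of classes (`stateSum_comap`).
-/

/-! ### Equivalence relations and the number of their classes -/

namespace Setoid

variable {V W : Type*}

/-- The equivalence relation that joins `a` to `b` and nothing else. -/
def join (a b : V) : Setoid V := Relation.EqvGen.setoid fun x y => x = a ∧ y = b

theorem join_le {a b : V} {s : Setoid V} : join a b ≤ s ↔ s a b := by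
  constructor
  · intro h
    exact h (Relation.EqvGen.rel _ _ ⟨rfl, rfl⟩)
  · intro h
    refine eqvGen_le ?_
    rintro x y ⟨rfl, rfl⟩
    exact h

theorem join_le_iff_mk_eq {a b : V} {s : Setoid V} :
    join a b ≤ s ↔ Quotient.mk s a = Quotient.mk s b :=
  join_le.trans Quotient.eq.symm

theorem join_comm (a b : V) : join a b = join b a := by
  refine eq_of_forall_ge_iff fun s => ?_
  rw [join_le, join_le, s.comm']

theorem join_self (a : V) : join a a = ⊥ :=
  le_bot_iff.1 (join_le.2 rfl)

/-- `m` is alone in its class. -/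
def Isolates (r : Setoid V) (m : V) : Prop := r ≤ ker (· = m)

theorem isolates_join {a b m : V} (ha : a ≠ m) (hb : b ≠ m) : (join a b).Isolates m :=
  join_le.2 (by simp [ker_def, ha, hb])

theorem Isolates.sup {r s : Setoid V} {m : V} (hr : r.Isolates m) (hs : s.Isolates m) :
    (r ⊔ s).Isolates m :=
  sup_le hr hs

/-- The number of classes. -/
noncomputable def numClasses (r : Setoid V) : ℕ := Nat.card (Quotient r)

theorem finite_quotient_mono {r s : Setoid V} (h : r ≤ s) [Finite (Quotient r)] :
    Finite (Quotient s) :=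
  Finite.of_surjective (map_of_le h) fun q => by
    induction q using Quotient.inductionOn with
    | h x => exact ⟨Quotient.mk r x, rfl⟩

theorem numClasses_sup_join {r : Setoid V} [Finite (Quotient r)] {m a : V} (hm : r.Isolates m)
    (ha : a ≠ m) : (r ⊔ join m a).numClasses + 1 = r.numClasses := by
  classical
  -- The classes of `r ⊔ join m a` are those of `r` without `{m}`,
  -- where `m` moves to the class of `a`.
  let g : V → Quotient r := fun u => if u = m then Quotient.mk r a else Quotient.mk r u
  have hker : r ⊔ join m a = ker g := by
    apply le_antisymm
    · refine sup_le ?_ (join_le.2 ?_)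
      · intro u v huv
        have h := hm huv
        simp only [ker_def, eq_iff_iff] at h
        by_cases hu : u = m
        · simp [hu, h.1 hu]
        · have hv : v ≠ m := fun hv => hu (h.2 hv)
          rw [ker_def]
          simp only [g, if_neg hu, if_neg hv]
          exact Quotient.sound huv
      · simp [ker_def, g]
    · have key : ∀ u, ∃ w, g u = Quotient.mk r w ∧ (r ⊔ join m a) u w := by
        intro u
        by_cases hu : u = m
        · refine ⟨a, by simp [g, hu], ?_⟩
          subst hu
          exact join_le.1 le_sup_right
        · exact ⟨u, by simp [g, hu], refl' _ u⟩
      intro u v huv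
      obtain ⟨u', h1, h2⟩ := key u
      obtain ⟨v', h3, h4⟩ := key v
      rw [ker_def, h1, h3, Quotient.eq] at huv
      exact trans' _ h2 (trans' _ ((le_sup_left : r ≤ _) huv) (symm' _ h4))
  have hrange : Set.range g = {Quotient.mk r m}ᶜ := by
    ext q
    induction q using Quotient.inductionOn with
    | h x =>
      simp only [Set.mem_range, Set.mem_compl_iff, Set.mem_singleton_iff, Quotient.eq]
      have hx : r x m ↔ x = m := by
        constructor
        · intro h
          simpa [ker_def] using hm h
        · rintro rfl
          exact refl' _ _
      rw [hx]
      constructor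
      · rintro ⟨y, hy⟩ rfl
        by_cases hym : y = x
        · have : Quotient.mk r a = Quotient.mk r x := by simpa [g, hym] using hy
          have h2 := hm (Quotient.eq.1 this)
          simp [ker_def, ha] at h2
        · have : Quotient.mk r y = Quotient.mk r x := by simpa [g, hym] using hy
          have h2 := hm (Quotient.eq.1 this)
          simp [ker_def, hym] at h2
      · intro h
        exact ⟨x, by simp [g, h]⟩
  rw [hker, numClasses, Nat.card_congr (quotientKerEquivRange g), numClasses,
    Nat.card_coe_set_eq, hrange, ← Set.ncard_singleton (Quotient.mk r m), add_comm,
    Set.ncard_add_ncard_compl]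

theorem comap_le_iff {f : V → W} (hf : Function.Surjective f) {r : Setoid W} {s : Setoid V}
    (h : ker f ≤ s) : comap f r ≤ s ↔ r ≤ s.map f := by
  have hs := comap_map_of_ker_le f s h
  constructor
  · intro h' u v huv
    obtain ⟨u, rfl⟩ := hf u
    obtain ⟨v, rfl⟩ := hf v
    exact le_comap_map (h' huv)
  · intro h' u v huv
    rw [← hs]
    exact h' huv

theorem ker_le_comap (f : V → W) (r : Setoid W) : ker f ≤ comap f r := fun u v huv => by
  rw [comap_rel, ker_def.1 huv]

theorem comap_mono (f : V → W) {r s : Setoid W} (h : r ≤ s) : comap f r ≤ comap f s :=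
  fun _ _ huv => h huv

theorem comap_sup {f : V → W} (hf : Function.Surjective f) (r s : Setoid W) :
    comap f (r ⊔ s) = comap f r ⊔ comap f s := by
  have hk : ker f ≤ comap f r ⊔ comap f s := (ker_le_comap f r).trans le_sup_left
  refine le_antisymm ?_ (sup_le (comap_mono f le_sup_left) (comap_mono f le_sup_right))
  rw [comap_le_iff hf hk]
  exact sup_le ((comap_le_iff hf hk).1 le_sup_left) ((comap_le_iff hf hk).1 le_sup_right)

theorem numClasses_comap {f : V → W} (hf : Function.Surjective f) (r : Setoid W) :
    (comap f r).numClasses = r.numClasses := by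
  have h : Function.Surjective (@Quotient.mk'' _ r ∘ f) := Quotient.mk''_surjective.comp hf
  rw [numClasses, comap_eq, Nat.card_congr (quotientKerEquivOfSurjective _ h), numClasses]

/-- The equivalence relation generated by `R` pulls back along a surjection `f` to `s`, once `s`
contains the kernel of `f`, maps into that relation, and covers the generators. -/
theorem comap_eqvGen_eq {f : V → W} (hf : Function.Surjective f) {R : W → W → Prop}
    {s : Setoid V} (hker : ker f ≤ s) (hle : s ≤ comap f (Relation.EqvGen.setoid R))
    (hgen : ∀ u v, R u v → ∃ u' v', f u' = u ∧ f v' = v ∧ s u' v') :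
    comap f (Relation.EqvGen.setoid R) = s := by
  refine le_antisymm ((comap_le_iff hf hker).2 (eqvGen_le ?_)) hle
  intro u v huv
  obtain ⟨u', v', rfl, rfl, h⟩ := hgen u v huv
  exact le_comap_map h

end Setoid

/-! ### State sums over a set of crossings -/

section StateSum

variable {V W α β R : Type*} [DecidableEq α] [DecidableEq β] [CommRing R]

/-- The state sum of the crossings in `T`, where `σ a μ` is the way in which the crossing `a` joins
the arcs when it carries the marker `μ`, and `r` are further joins of arcs. A circle has the
value `d`, a positive marker the weight `A`, and a negative one the weight `B`. -/
noncomputable def stateSum (A B d : R) (T : Finset α) (σ : α → Bool → Setoid V) (r : Setoid V) :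
    R :=
  ∑ S ∈ T.powerset, A ^ S.card * B ^ (T \ S).card *
    d ^ (r ⊔ T.sup fun a => σ a (decide (a ∈ S))).numClasses

theorem stateSum_insert (A B d : R) {T : Finset α} {a : α} (ha : a ∉ T)
    (σ : α → Bool → Setoid V) (r : Setoid V) :
    stateSum A B d (insert a T) σ r =
      A * stateSum A B d T σ (r ⊔ σ a true) + B * stateSum A B d T σ (r ⊔ σ a false) := by
  rw [stateSum, Finset.sum_powerset_insert ha, add_comm]
  simp only [stateSum, Finset.mul_sum]
  congr 1
  · refine Finset.sum_congr rfl fun S hS => ?_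
    have haS : a ∉ S := fun h => ha (Finset.mem_powerset.1 hS h)
    have h1 : insert a T \ insert a S = T \ S := by
      ext b
      by_cases hb : b = a
      · simp [hb, ha]
      · simp [hb]
    have h2 : (T.sup fun b => σ b (decide (b ∈ insert a S))) =
        T.sup fun b => σ b (decide (b ∈ S)) := by
      refine Finset.sup_congr rfl fun b hb => ?_
      have : b ≠ a := fun h => ha (h ▸ hb)
      simp [this]
    rw [h1, Finset.card_insert_of_notMem haS, Finset.sup_insert, h2, sup_assoc]
    simp only [Finset.mem_insert_self, decide_true]
    ring
  · refine Finset.sum_congr rfl fun S hS => ?_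
    have haS : a ∉ S := fun h => ha (Finset.mem_powerset.1 hS h)
    rw [Finset.insert_sdiff_of_notMem _ haS,
      Finset.card_insert_of_notMem (fun h => ha (Finset.mem_sdiff.1 h).1), Finset.sup_insert,
      sup_assoc]
    simp only [haS, decide_false]
    ring

theorem stateSum_congr (A B d : R) {T : Finset α} {σ σ' : α → Bool → Setoid V}
    (h : ∀ a ∈ T, ∀ μ, σ a μ = σ' a μ) (r : Setoid V) :
    stateSum A B d T σ r = stateSum A B d T σ' r := by
  refine Finset.sum_congr rfl fun S _ => ?_
  rw [Finset.sup_congr rfl fun a ha => h a ha _]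

theorem stateSum_image (A B d : R) {T : Finset α} {f : α → β} (hf : Function.Injective f)
    (σ : β → Bool → Setoid V) (r : Setoid V) :
    stateSum A B d (T.image f) σ r = stateSum A B d T (fun a => σ (f a)) r := by
  induction T using Finset.induction_on generalizing r with
  | empty => simp [stateSum]
  | insert a T ha ih =>
    have : f a ∉ T.image f := by simpa [hf.eq_iff] using ha
    rw [Finset.image_insert, stateSum_insert _ _ _ this, stateSum_insert _ _ _ ha, ih, ih]

/-- Collapsing the arcs along `f` does not change the state sum. -/
theorem stateSum_comap (A B d : R) {T : Finset α} {f : V → W} (hf : Function.Surjective f)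
    {σ : α → Bool → Setoid V} {τ : α → Bool → Setoid W}
    (h : ∀ a ∈ T, ∀ μ, Setoid.comap f (τ a μ) = σ a μ ⊔ Setoid.ker f) {r : Setoid V}
    {s : Setoid W} (hr : Setoid.comap f s = r) :
    stateSum A B d T σ r = stateSum A B d T τ s := by
  induction T using Finset.induction_on generalizing r s with
  | empty => simp [stateSum, ← hr, Setoid.numClasses_comap hf]
  | insert a T ha ih =>
    have hk : Setoid.ker f ≤ r := hr ▸ Setoid.ker_le_comap f s
    have step : ∀ μ, Setoid.comap f (s ⊔ τ a μ) = r ⊔ σ a μ := fun μ => by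
      rw [Setoid.comap_sup hf, hr, h a (Finset.mem_insert_self _ _), sup_comm (σ a μ),
        ← sup_assoc, sup_eq_left.2 hk]
    rw [stateSum_insert _ _ _ ha, stateSum_insert _ _ _ ha,
      ih (fun b hb => h b (Finset.mem_insert_of_mem hb)) (step true),
      ih (fun b hb => h b (Finset.mem_insert_of_mem hb)) (step false)]

/-- The functional `F` on equivalence relations loses a factor `d` when the isolated arc `m` is
joined to another arc. -/
def Eliminates (F : Setoid V → R) (d : R) (m : V) : Prop :=
  ∀ r : Setoid V, r.Isolates m → ∀ a, a ≠ m → d * F (r ⊔ Setoid.join m a) = F r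

theorem eliminates_stateSum (A B d : R) {T : Finset α} {σ : α → Bool → Setoid V} {r₀ : Setoid V}
    [Finite (Quotient r₀)] {m : V} (h₀ : r₀.Isolates m)
    (h : ∀ a ∈ T, ∀ μ, (σ a μ).Isolates m) :
    Eliminates (fun r => stateSum A B d T σ (r₀ ⊔ r)) d m := by
  intro r hr a ha
  simp only [stateSum, Finset.mul_sum]
  refine Finset.sum_congr rfl fun S _ => ?_
  set s := T.sup fun a => σ a (decide (a ∈ S)) with hs
  have hsm : s.Isolates m := Finset.sup_le fun b hb => h b hb _
  have hfin : Finite (Quotient (r₀ ⊔ r ⊔ s)) :=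
    Setoid.finite_quotient_mono (le_sup_left.trans le_sup_left : r₀ ≤ _)
  have key := Setoid.numClasses_sup_join ((h₀.sup hr).sup hsm) ha
  rw [← key, pow_succ, ← sup_assoc, sup_right_comm]
  ring

end StateSum

/-! ### Skein relations for the local pictures -/

section Local

open Setoid

variable {V R : Type*} [CommRing R]

/-- The smoothing of two strands `a → b` and `c → d` that respects the orientations. -/
def orientedJoin (a b c d : V) : Setoid V := join a d ⊔ join c b

/-- The smoothing of two strands `a → b` and `c → d` that does not respect the orientations. -/
def unorientedJoin (a b c d : V) : Setoid V := join a c ⊔ join b d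

/-- Three isolated arcs that get joined to other arcs cost the factor `d ^ 3`. -/
theorem Eliminates.three {F : Setoid V → R} {d : R} {m₀ m₁ m₂ : V} (h₀ : Eliminates F d m₀)
    (h₁ : Eliminates F d m₁) (h₂ : Eliminates F d m₂) (h₀₁ : m₀ ≠ m₁) (h₀₂ : m₀ ≠ m₂)
    (h₁₂ : m₁ ≠ m₂) {s r : Setoid V} {a₀ a₁ a₂ : V} (hs₀ : s.Isolates m₀) (hs₁ : s.Isolates m₁)
    (hs₂ : s.Isolates m₂) (ha₀ : a₀ ≠ m₀) (ha₀₁ : a₀ ≠ m₁) (ha₀₂ : a₀ ≠ m₂) (ha₁ : a₁ ≠ m₁)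
    (ha₁₂ : a₁ ≠ m₂) (ha₂ : a₂ ≠ m₂)
    (hr : r = s ⊔ join m₀ a₀ ⊔ join m₁ a₁ ⊔ join m₂ a₂) :
    d ^ 3 * F r = F s := by
  have e₂ := h₂ (s ⊔ join m₀ a₀ ⊔ join m₁ a₁)
    ((hs₂.sup (isolates_join h₀₂ ha₀₂)).sup (isolates_join h₁₂ ha₁₂)) a₂ ha₂
  have e₁ := h₁ (s ⊔ join m₀ a₀) (hs₁.sup (isolates_join h₀₁ ha₀₁)) a₁ ha₁
  have e₀ := h₀ s hs₀ a₀ ha₀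
  rw [← hr] at e₂
  linear_combination d ^ 2 * e₂ + d * e₁ + e₀

/-- The value of the triangle of a third Reidemeister move with positive crossings, where the
strand `i` runs through the arcs `pᵢ`, `mᵢ`, `qᵢ`. -/
def triangleValue (F : Setoid V → R) (A B : R) (p₀ q₀ p₁ q₁ p₂ q₂ : V) : R :=
  A ^ 3 * F (join p₀ q₂ ⊔ join p₁ q₁ ⊔ join p₂ q₀) +
    A * (F (join p₀ q₂ ⊔ join p₁ p₂ ⊔ join q₀ q₁) + F (join p₀ p₁ ⊔ join p₂ q₀ ⊔ join q₁ q₂)) +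
    B * (F (join p₀ q₀ ⊔ join p₁ p₂ ⊔ join q₁ q₂) + F (join p₀ p₁ ⊔ join p₂ q₂ ⊔ join q₀ q₁))

/-- The symmetry that proves the third Reidemeister move: after the move, the picture is the same
triangle with all three strands read backwards. -/
theorem triangleValue_reverse (F : Setoid V → R) (A B : R) (p₀ q₀ p₁ q₁ p₂ q₂ : V) :
    triangleValue F A B q₀ p₀ q₁ p₁ q₂ p₂ = triangleValue F A B p₀ q₀ p₁ q₁ p₂ q₂ := by
  have e₁ : join q₀ p₂ ⊔ join q₁ p₁ ⊔ join q₂ p₀ = join p₀ q₂ ⊔ join p₁ q₁ ⊔ join p₂ q₀ := by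
    rw [join_comm q₀, join_comm q₁, join_comm q₂, sup_comm, sup_comm (join p₂ q₀), ← sup_assoc]
  have e₂ : join q₀ p₂ ⊔ join q₁ q₂ ⊔ join p₀ p₁ = join p₀ p₁ ⊔ join p₂ q₀ ⊔ join q₁ q₂ := by
    rw [join_comm q₀, sup_comm, ← sup_assoc]
  have e₃ : join q₀ q₁ ⊔ join q₂ p₀ ⊔ join p₁ p₂ = join p₀ q₂ ⊔ join p₁ p₂ ⊔ join q₀ q₁ := by
    rw [join_comm q₂, sup_assoc, sup_comm]
  have e₄ : join q₀ p₀ ⊔ join q₁ q₂ ⊔ join p₁ p₂ = join p₀ q₀ ⊔ join p₁ p₂ ⊔ join q₁ q₂ := by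
    rw [join_comm q₀, sup_right_comm]
  have e₅ : join q₀ q₁ ⊔ join q₂ p₂ ⊔ join p₀ p₁ = join p₀ p₁ ⊔ join p₂ q₂ ⊔ join q₀ q₁ := by
    rw [join_comm q₂, sup_comm, sup_comm (join q₀ q₁), ← sup_assoc]
  simp only [triangleValue, e₁, e₂, e₃, e₄, e₅]
  ring

/-- The Kauffman state sum of a triangle: the strands `0` and `1` cross first, then `0` and `2`,
then `1` and `2`. -/
theorem triangle_eval {F : Setoid V → R} {A B d : R} (hAB : A * B = 1) (hd : d = -A ^ 2 - B ^ 2)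
    {p₀ m₀ q₀ p₁ m₁ q₁ p₂ m₂ q₂ : V} (h₀ : Eliminates F d m₀) (h₁ : Eliminates F d m₁)
    (h₂ : Eliminates F d m₂)
    (hne : [m₀, m₁, m₂].Nodup) (hp : ∀ a ∈ [p₀, q₀, p₁, q₁, p₂, q₂], a ≠ m₀ ∧ a ≠ m₁ ∧ a ≠ m₂)
    {α β γ α' β' γ' : Setoid V}
    (hα : α = orientedJoin p₀ m₀ p₁ m₁) (hα' : α' = unorientedJoin p₀ m₀ p₁ m₁)
    (hβ : β = orientedJoin m₀ q₀ p₂ m₂) (hβ' : β' = unorientedJoin m₀ q₀ p₂ m₂)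
    (hγ : γ = orientedJoin m₁ q₁ m₂ q₂) (hγ' : γ' = unorientedJoin m₁ q₁ m₂ q₂) :
    d ^ 3 * (A ^ 3 * F (α ⊔ β ⊔ γ) + A * (F (α ⊔ β ⊔ γ') + F (α ⊔ β' ⊔ γ) + F (α' ⊔ β ⊔ γ)) +
      B * (F (α ⊔ β' ⊔ γ') + F (α' ⊔ β ⊔ γ') + F (α' ⊔ β' ⊔ γ)) + B ^ 3 * F (α' ⊔ β' ⊔ γ')) =
    triangleValue F A B p₀ q₀ p₁ q₁ p₂ q₂ := by
  simp only [List.nodup_cons, List.mem_cons, List.not_mem_nil, or_false, not_or,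
    not_false_eq_true, List.nodup_nil, and_true] at hne
  obtain ⟨⟨h₀₁, h₀₂⟩, h₁₂⟩ := hne
  simp only [List.mem_cons, List.not_mem_nil, or_false, forall_eq_or_imp, forall_eq] at hp
  obtain ⟨⟨hp00, hp01, hp02⟩, ⟨hq00, hq01, hq02⟩, ⟨hp10, hp11, hp12⟩, ⟨hq10, hq11, hq12⟩,
    ⟨hp20, hp21, hp22⟩, ⟨hq20, hq21, hq22⟩⟩ := hp
  have iso : ∀ {m a b c d e f : V}, a ≠ m → b ≠ m → c ≠ m → d ≠ m → e ≠ m → f ≠ m →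
      (join a b ⊔ join c d ⊔ join e f).Isolates m := fun h1 h2 h3 h4 h5 h6 =>
    ((isolates_join h1 h2).sup (isolates_join h3 h4)).sup (isolates_join h5 h6)
  have h₁₀ := Ne.symm h₀₁
  have h₂₀ := Ne.symm h₀₂
  have h₂₁ := Ne.symm h₁₂
  subst hα hα' hβ hβ' hγ hγ'
  simp only [orientedJoin, unorientedJoin]
  have e₁ : d ^ 3 * F (join p₀ m₁ ⊔ join p₁ m₀ ⊔ (join m₀ m₂ ⊔ join p₂ q₀) ⊔
      (join m₁ q₂ ⊔ join m₂ q₁)) = F (join p₀ q₂ ⊔ join p₁ q₁ ⊔ join p₂ q₀) := by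
    refine Eliminates.three h₀ h₁ h₂ h₀₁ h₀₂ h₁₂ (a₀ := p₁) (a₁ := p₀) (a₂ := q₁)
      ?_ ?_ ?_ ?_ ?_ ?_ ?_ ?_ ?_ ?_
    on_goal 10 =>
      refine eq_of_forall_ge_iff fun u => ?_
      simp only [sup_le_iff, join_le_iff_mk_eq]
      grind
    all_goals first | assumption | (apply iso <;> assumption)
  have e₂ : d ^ 3 * F (join p₀ m₁ ⊔ join p₁ m₀ ⊔ (join m₀ m₂ ⊔ join p₂ q₀) ⊔
      (join m₁ m₂ ⊔ join q₁ q₂)) = F (join p₀ p₁ ⊔ join p₂ q₀ ⊔ join q₁ q₂) := by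
    refine Eliminates.three h₀ h₁ h₂ h₀₁ h₀₂ h₁₂ (a₀ := p₁) (a₁ := p₀) (a₂ := p₁)
      ?_ ?_ ?_ ?_ ?_ ?_ ?_ ?_ ?_ ?_
    on_goal 10 =>
      refine eq_of_forall_ge_iff fun u => ?_
      simp only [sup_le_iff, join_le_iff_mk_eq]
      grind
    all_goals first | assumption | (apply iso <;> assumption)
  have e₃ : d ^ 3 * F (join p₀ m₁ ⊔ join p₁ m₀ ⊔ (join m₀ p₂ ⊔ join q₀ m₂) ⊔
      (join m₁ q₂ ⊔ join m₂ q₁)) = F (join p₀ q₂ ⊔ join p₁ p₂ ⊔ join q₀ q₁) := by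
    refine Eliminates.three h₀ h₁ h₂ h₀₁ h₀₂ h₁₂ (a₀ := p₁) (a₁ := p₀) (a₂ := q₀)
      ?_ ?_ ?_ ?_ ?_ ?_ ?_ ?_ ?_ ?_
    on_goal 10 =>
      refine eq_of_forall_ge_iff fun u => ?_
      simp only [sup_le_iff, join_le_iff_mk_eq]
      grind
    all_goals first | assumption | (apply iso <;> assumption)
  have e₄ : d ^ 3 * F (join p₀ p₁ ⊔ join m₀ m₁ ⊔ (join m₀ m₂ ⊔ join p₂ q₀) ⊔
      (join m₁ q₂ ⊔ join m₂ q₁)) = F (join p₀ p₁ ⊔ join p₂ q₀ ⊔ join q₁ q₂) := by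
    refine Eliminates.three h₀ h₁ h₂ h₀₁ h₀₂ h₁₂ (a₀ := q₁) (a₁ := q₂) (a₂ := q₁)
      ?_ ?_ ?_ ?_ ?_ ?_ ?_ ?_ ?_ ?_
    on_goal 10 =>
      refine eq_of_forall_ge_iff fun u => ?_
      simp only [sup_le_iff, join_le_iff_mk_eq]
      grind
    all_goals first | assumption | (apply iso <;> assumption)
  have e₅ : d ^ 3 * F (join p₀ m₁ ⊔ join p₁ m₀ ⊔ (join m₀ p₂ ⊔ join q₀ m₂) ⊔
      (join m₁ m₂ ⊔ join q₁ q₂)) = F (join p₀ q₀ ⊔ join p₁ p₂ ⊔ join q₁ q₂) := by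
    refine Eliminates.three h₀ h₁ h₂ h₀₁ h₀₂ h₁₂ (a₀ := p₁) (a₁ := p₀) (a₂ := p₀)
      ?_ ?_ ?_ ?_ ?_ ?_ ?_ ?_ ?_ ?_
    on_goal 10 =>
      refine eq_of_forall_ge_iff fun u => ?_
      simp only [sup_le_iff, join_le_iff_mk_eq]
      grind
    all_goals first | assumption | (apply iso <;> assumption)
  have e₆ : d ^ 3 * F (join p₀ p₁ ⊔ join m₀ m₁ ⊔ (join m₀ p₂ ⊔ join q₀ m₂) ⊔
      (join m₁ q₂ ⊔ join m₂ q₁)) = F (join p₀ p₁ ⊔ join p₂ q₂ ⊔ join q₀ q₁) := by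
    refine Eliminates.three h₀ h₁ h₂ h₀₁ h₀₂ h₁₂ (a₀ := p₂) (a₁ := p₂) (a₂ := q₀)
      ?_ ?_ ?_ ?_ ?_ ?_ ?_ ?_ ?_ ?_
    on_goal 10 =>
      refine eq_of_forall_ge_iff fun u => ?_
      simp only [sup_le_iff, join_le_iff_mk_eq]
      grind
    all_goals first | assumption | (apply iso <;> assumption)
  have e₇ : d ^ 3 * F (join p₀ p₁ ⊔ join m₀ m₁ ⊔ (join m₀ p₂ ⊔ join q₀ m₂) ⊔
      (join m₁ m₂ ⊔ join q₁ q₂)) = F (join p₀ p₁ ⊔ join p₂ q₀ ⊔ join q₁ q₂) := by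
    refine Eliminates.three h₀ h₁ h₂ h₀₁ h₀₂ h₁₂ (a₀ := p₂) (a₁ := p₂) (a₂ := p₂)
      ?_ ?_ ?_ ?_ ?_ ?_ ?_ ?_ ?_ ?_
    on_goal 10 =>
      refine eq_of_forall_ge_iff fun u => ?_
      simp only [sup_le_iff, join_le_iff_mk_eq]
      grind
    all_goals first | assumption | (apply iso <;> assumption)
  -- In this state the three inner arcs form a circle of their own.
  have e₈ : d ^ 2 * F (join p₀ p₁ ⊔ join m₀ m₁ ⊔ (join m₀ m₂ ⊔ join p₂ q₀) ⊔
      (join m₁ m₂ ⊔ join q₁ q₂)) = F (join p₀ p₁ ⊔ join p₂ q₀ ⊔ join q₁ q₂) := by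
    have s₁ := h₁ (join p₀ p₁ ⊔ join p₂ q₀ ⊔ join q₁ q₂) (by apply iso <;> assumption) m₀ h₀₁
    have s₂ := h₂ ((join p₀ p₁ ⊔ join p₂ q₀ ⊔ join q₁ q₂) ⊔ join m₁ m₀)
      ((by apply iso <;> assumption : Isolates _ m₂).sup (isolates_join h₁₂ h₀₂)) m₀ h₀₂
    have e : (join p₀ p₁ ⊔ join m₀ m₁ ⊔ (join m₀ m₂ ⊔ join p₂ q₀) ⊔ (join m₁ m₂ ⊔ join q₁ q₂)) =
        (join p₀ p₁ ⊔ join p₂ q₀ ⊔ join q₁ q₂) ⊔ join m₁ m₀ ⊔ join m₂ m₀ := by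
      refine eq_of_forall_ge_iff fun u => ?_
      simp only [sup_le_iff, join_le_iff_mk_eq]
      grind
    rw [e]
    linear_combination d * s₂ + s₁
  simp only [triangleValue]
  linear_combination A ^ 3 * e₁ + A * (e₂ + e₃ + e₄) + B * (e₅ + e₆) + B * d * e₈ + B ^ 3 * e₇ +
    F (join p₀ p₁ ⊔ join p₂ q₀ ⊔ join q₁ q₂) * (B * hd - A * hAB)

/-- The bigon of a second Reidemeister move, with strands `p₀ → m₀ → q₀` and `p₁ → m₁ → q₁`, can be
replaced by two disjoint strands. The first crossing has the smoothings `α` (marker of weight `A`)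
and `α'`, the second one `β` and `β'`. -/
theorem bigon_eval {F : Setoid V → R} {A B d : R} (hd : d = -A ^ 2 - B ^ 2)
    {p₀ m₀ q₀ p₁ m₁ q₁ : V} (h₀ : Eliminates F d m₀) (h₁ : Eliminates F d m₁) (h₀₁ : m₀ ≠ m₁)
    (hp : ∀ a ∈ [p₀, q₀, p₁, q₁], a ≠ m₀ ∧ a ≠ m₁) {α β α' β' : Setoid V}
    (hα : α = join p₀ m₁ ⊔ join p₁ m₀) (hα' : α' = join p₀ p₁ ⊔ join m₀ m₁)
    (hβ : β = join m₀ m₁ ⊔ join q₀ q₁) (hβ' : β' = join m₀ q₁ ⊔ join m₁ q₀) :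
    d ^ 2 * (A ^ 2 * F (α ⊔ β) + F (α ⊔ β') + F (α' ⊔ β) + B ^ 2 * F (α' ⊔ β')) =
      d ^ 2 * F (join p₀ q₀ ⊔ join p₀ m₀ ⊔ (join p₁ q₁ ⊔ join p₁ m₁)) := by
  simp only [List.mem_cons, List.not_mem_nil, or_false, forall_eq_or_imp, forall_eq] at hp
  obtain ⟨⟨hp00, hp01⟩, ⟨hq00, hq01⟩, ⟨hp10, hp11⟩, ⟨hq10, hq11⟩⟩ := hp
  have h₁₀ := Ne.symm h₀₁
  subst hα hα' hβ hβ'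
  have iso : ∀ {m a b c d : V}, a ≠ m → b ≠ m → c ≠ m → d ≠ m →
      (join a b ⊔ join c d).Isolates m := fun h1 h2 h3 h4 =>
    (isolates_join h1 h2).sup (isolates_join h3 h4)
  have two : ∀ {s r : Setoid V} {a₀ a₁ : V}, s.Isolates m₀ → s.Isolates m₁ → a₀ ≠ m₀ → a₀ ≠ m₁ →
      a₁ ≠ m₁ → r = s ⊔ join m₀ a₀ ⊔ join m₁ a₁ → d ^ 2 * F r = F s := by
    intro s r a₀ a₁ i₀ i₁ n₀ n₀₁ n₁ hr
    have e₁ := h₁ (s ⊔ join m₀ a₀) (i₁.sup (isolates_join h₀₁ n₀₁)) a₁ n₁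
    have e₀ := h₀ s i₀ a₀ n₀
    rw [← hr] at e₁
    linear_combination d * e₁ + e₀
  have e₁ : d ^ 2 * F (join p₀ m₁ ⊔ join p₁ m₀ ⊔ (join m₀ m₁ ⊔ join q₀ q₁)) =
      F (join p₀ p₁ ⊔ join q₀ q₁) := by
    refine two (a₀ := p₁) (a₁ := p₀) ?_ ?_ ?_ ?_ ?_ ?_
    on_goal 6 =>
      refine eq_of_forall_ge_iff fun u => ?_
      simp only [sup_le_iff, join_le_iff_mk_eq]
      grind
    all_goals first | assumption | (apply iso <;> assumption)
  have e₂ : d ^ 2 * F (join p₀ m₁ ⊔ join p₁ m₀ ⊔ (join m₀ q₁ ⊔ join m₁ q₀)) =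
      F (join p₀ q₀ ⊔ join p₁ q₁) := by
    refine two (a₀ := p₁) (a₁ := p₀) ?_ ?_ ?_ ?_ ?_ ?_
    on_goal 6 =>
      refine eq_of_forall_ge_iff fun u => ?_
      simp only [sup_le_iff, join_le_iff_mk_eq]
      grind
    all_goals first | assumption | (apply iso <;> assumption)
  have e₃ : d ^ 2 * F (join p₀ p₁ ⊔ join m₀ m₁ ⊔ (join m₀ q₁ ⊔ join m₁ q₀)) =
      F (join p₀ p₁ ⊔ join q₀ q₁) := by
    refine two (a₀ := q₁) (a₁ := q₀) ?_ ?_ ?_ ?_ ?_ ?_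
    on_goal 6 =>
      refine eq_of_forall_ge_iff fun u => ?_
      simp only [sup_le_iff, join_le_iff_mk_eq]
      grind
    all_goals first | assumption | (apply iso <;> assumption)
  have e₄ : d ^ 2 * F (join p₀ q₀ ⊔ join p₀ m₀ ⊔ (join p₁ q₁ ⊔ join p₁ m₁)) =
      F (join p₀ q₀ ⊔ join p₁ q₁) := by
    refine two (a₀ := p₀) (a₁ := p₁) ?_ ?_ ?_ ?_ ?_ ?_
    on_goal 6 =>
      refine eq_of_forall_ge_iff fun u => ?_
      simp only [sup_le_iff, join_le_iff_mk_eq]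
      grind
    all_goals first | assumption | (apply iso <;> assumption)
  -- In this state the two inner arcs form a circle of their own.
  have e₅ : d * F (join p₀ p₁ ⊔ join m₀ m₁ ⊔ (join m₀ m₁ ⊔ join q₀ q₁)) =
      F (join p₀ p₁ ⊔ join q₀ q₁) := by
    have s₁ := h₁ (join p₀ p₁ ⊔ join q₀ q₁) (by apply iso <;> assumption) m₀ h₀₁
    have e : (join p₀ p₁ ⊔ join m₀ m₁ ⊔ (join m₀ m₁ ⊔ join q₀ q₁)) =
        (join p₀ p₁ ⊔ join q₀ q₁) ⊔ join m₁ m₀ := by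
      refine eq_of_forall_ge_iff fun u => ?_
      simp only [sup_le_iff, join_le_iff_mk_eq]
      grind
    rw [e, s₁]
  linear_combination A ^ 2 * e₁ + e₂ - e₄ + d * e₅ + B ^ 2 * e₃ + F (join p₀ p₁ ⊔ join q₀ q₁) * hd

/-- The kink of a first Reidemeister move, with the strand `p → m → q`, can be straightened at the
cost of a factor. -/
theorem kink_eval {F : Setoid V → R} {A B d : R} (hAB : A * B = 1) (hd : d = -A ^ 2 - B ^ 2)
    {p m q : V} (hm : Eliminates F d m) (hp : p ≠ m) (hq : q ≠ m) :
    A * F (orientedJoin p m m q) + B * F (unorientedJoin p m m q) =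
      -A ^ 3 * F (join p q ⊔ join p m) := by
  have e₁ := hm (join p q) (isolates_join hp hq) p hp
  have e₂ : orientedJoin p m m q = join p q := by
    rw [orientedJoin, join_self, sup_bot_eq]
  have e₃ : unorientedJoin p m m q = join p q ⊔ join p m := by
    refine eq_of_forall_ge_iff fun u => ?_
    simp only [unorientedJoin, sup_le_iff, join_le_iff_mk_eq]
    grind
  have e₄ : join p q ⊔ join m p = join p q ⊔ join p m := by rw [join_comm m]
  rw [e₄] at e₁
  rw [e₂, e₃, ← e₁]
  linear_combination F (join p q ⊔ join p m) * (A * hd - B * hAB)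

end Local

/-! ### Smoothings of words -/

section Words

open Setoid

variable {α : Type*}

/-- The way in which the smoothing of the chord `a` of the word `w` joins the arcs; `o` tells
whether it respects the orientation. The arcs are numbered so that the arc `j` runs into the letter
at the position `j` and the arc `j + 1` runs out of it. -/
def smoothing (w : List α) (a : α) (o : Bool) : Setoid ℕ :=
  Relation.EqvGen.setoid fun u v => ∃ j k, j ≠ k ∧ w[j]? = some a ∧ w[k]? = some a ∧
    if o then u = j ∧ v = k + 1 else (u = j ∧ v = k) ∨ (u = j + 1 ∧ v = k + 1)

/-- The closure of a long curve with `n` letters: the first arc `0` is joined to the last arc `n`.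
All natural numbers beyond `n`, which number no arcs, are put into the same class, so that the arcs
of all words are numbered by the same type. -/
def closing (n : ℕ) : Setoid ℕ := Relation.EqvGen.setoid fun u v => u = 0 ∧ n ≤ v

theorem closing_le {n : ℕ} {s : Setoid ℕ} : closing n ≤ s ↔ ∀ v, n ≤ v → s 0 v := by
  constructor
  · intro h v hv
    exact h (Relation.EqvGen.rel _ _ ⟨rfl, hv⟩)
  · intro h
    refine eqvGen_le ?_
    rintro _ v ⟨rfl, hv⟩
    exact h v hv

theorem smoothing_true_le {w : List α} {a : α} {s : Setoid ℕ} :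
    smoothing w a true ≤ s ↔
      ∀ j k, j ≠ k → w[j]? = some a → w[k]? = some a → s j (k + 1) := by
  constructor
  · intro h j k hjk hj hk
    exact h (Relation.EqvGen.rel _ _ ⟨j, k, hjk, hj, hk, by simp⟩)
  · intro h
    refine eqvGen_le ?_
    rintro _ _ ⟨j, k, hjk, hj, hk, h'⟩
    simp only [if_true] at h'
    obtain ⟨rfl, rfl⟩ := h'
    exact h _ _ hjk hj hk

theorem smoothing_false_le {w : List α} {a : α} {s : Setoid ℕ} :
    smoothing w a false ≤ s ↔
      ∀ j k, j ≠ k → w[j]? = some a → w[k]? = some a → s j k ∧ s (j + 1) (k + 1) := by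
  constructor
  · intro h j k hjk hj hk
    exact ⟨h (Relation.EqvGen.rel _ _ ⟨j, k, hjk, hj, hk, by simp⟩),
      h (Relation.EqvGen.rel _ _ ⟨j, k, hjk, hj, hk, by simp⟩)⟩
  · intro h
    refine eqvGen_le ?_
    rintro _ _ ⟨j, k, hjk, hj, hk, h'⟩
    simp only [Bool.false_eq_true, if_false] at h'
    obtain ⟨rfl, rfl⟩ | ⟨rfl, rfl⟩ := h'
    · exact (h _ _ hjk hj hk).1
    · exact (h _ _ hjk hj hk).2

theorem finite_quotient_closing (n : ℕ) : Finite (Quotient (closing n)) := by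
  refine Finite.of_surjective (fun i : Fin (n + 1) => Quotient.mk (closing n) i) fun q => ?_
  induction q using Quotient.inductionOn with
  | h x =>
    have h := closing_le.1 (le_refl (closing n))
    by_cases hx : x ≤ n
    · exact ⟨⟨x, by omega⟩, rfl⟩
    · exact ⟨⟨0, by omega⟩, Quotient.sound (h x (by omega))⟩

theorem closing_isolates {n m : ℕ} (h0 : 0 < m) (hm : m < n) : (closing n).Isolates m := by
  refine closing_le.2 fun v hv => ?_
  have h1 : (0 : ℕ) ≠ m := by omega
  have h2 : v ≠ m := by omega
  simp [ker_def, h1, h2]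

theorem smoothing_isolates {w : List α} {a : α} {m : ℕ} (h : w[m]? ≠ some a)
    (h' : ∀ i : ℕ, i + 1 = m → w[i]? ≠ some a) (o : Bool) : (smoothing w a o).Isolates m := by
  have h1 : ∀ j : ℕ, w[j]? = some a → j ≠ m := by
    rintro j hj rfl
    exact h hj
  have h2 : ∀ j : ℕ, w[j]? = some a → j + 1 ≠ m := fun j hj hm =>
    h' j hm hj
  cases o
  · refine smoothing_false_le.2 fun j k _ hj hk => ?_
    simp [ker_def, h1 j hj, h2 j hj, h1 k hk, h2 k hk]
  · refine smoothing_true_le.2 fun j k _ hj hk => ?_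
    simp [ker_def, h1 j hj, h2 k hk]

theorem smoothing_congr {β : Type*} {w : List α} {w' : List β} {a : α} {b : β}
    (h : ∀ i : ℕ, w[i]? = some a ↔ w'[i]? = some b) (o : Bool) :
    smoothing w a o = smoothing w' b o := by
  simp only [smoothing, h]

theorem smoothing_true_eq {w : List α} {a : α} {j k : ℕ} (hjk : j ≠ k)
    (h : ∀ i, w[i]? = some a ↔ i = j ∨ i = k) :
    smoothing w a true = orientedJoin j (j + 1) k (k + 1) := by
  refine eq_of_forall_ge_iff fun s => ?_
  rw [smoothing_true_le, orientedJoin, sup_le_iff, join_le, join_le]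
  simp only [h]
  constructor
  · intro h'
    exact ⟨h' j k hjk (.inl rfl) (.inr rfl), h' k j hjk.symm (.inr rfl) (.inl rfl)⟩
  · rintro ⟨h1, h2⟩ _ _ hne (rfl | rfl) (rfl | rfl)
    exacts [absurd rfl hne, h1, h2, absurd rfl hne]

theorem smoothing_false_eq {w : List α} {a : α} {j k : ℕ} (hjk : j ≠ k)
    (h : ∀ i, w[i]? = some a ↔ i = j ∨ i = k) :
    smoothing w a false = unorientedJoin j (j + 1) k (k + 1) := by
  refine eq_of_forall_ge_iff fun s => ?_
  rw [smoothing_false_le, unorientedJoin, sup_le_iff, join_le, join_le]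
  simp only [h]
  constructor
  · intro h'
    exact h' j k hjk (.inl rfl) (.inr rfl)
  · rintro ⟨h1, h2⟩ _ _ hne (rfl | rfl) (rfl | rfl)
    exacts [absurd rfl hne, ⟨h1, h2⟩, ⟨s.symm' h1, s.symm' h2⟩, absurd rfl hne]

/-- Let the word `w'` arise from `w` by inserting letters different from `a`, let `g` be the map of
positions, and let `f` collapse the new arcs. Up to this collapse, the chord `a` has the same
smoothings in both words. -/
theorem comap_smoothing {w w' : List α} {a : α} {f g : ℕ → ℕ} (hf : Function.Surjective f)
    (hg : ∀ j, f (g j) = j ∧ f (g j + 1) = j + 1) (hw : ∀ j, w[j]? = some a → w'[g j]? = some a)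
    (hw' : ∀ k, w'[k]? = some a → ∃ j, k = g j ∧ w[j]? = some a) (o : Bool) :
    comap f (smoothing w a o) = smoothing w' a o ⊔ ker f := by
  have hinj : ∀ {j k}, j ≠ k → g j ≠ g k := fun {j k} hjk h =>
    hjk (by rw [← (hg j).1, h, (hg k).1])
  refine comap_eqvGen_eq hf le_sup_right (sup_le ?_ (ker_le_comap _ _)) ?_
  · change _ ≤ comap f (smoothing w a o)
    cases o
    · have key := smoothing_false_le.1 (le_refl (smoothing w a false))
      refine smoothing_false_le.2 fun j' k' hne hj' hk' => ?_
      obtain ⟨j, rfl, hj⟩ := hw' j' hj'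
      obtain ⟨k, rfl, hk⟩ := hw' k' hk'
      simp only [comap_rel, (hg j).1, (hg j).2, (hg k).1, (hg k).2]
      exact key j k (fun h => hne (h ▸ rfl)) hj hk
    · have key := smoothing_true_le.1 (le_refl (smoothing w a true))
      refine smoothing_true_le.2 fun j' k' hne hj' hk' => ?_
      obtain ⟨j, rfl, hj⟩ := hw' j' hj'
      obtain ⟨k, rfl, hk⟩ := hw' k' hk'
      rw [comap_rel, (hg j).1, (hg k).2]
      exact key j k (fun h => hne (h ▸ rfl)) hj hk
  · have hle : smoothing w' a o ≤ smoothing w' a o ⊔ ker f := le_sup_left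
    rintro u v ⟨j, k, hne, hj, hk, h⟩
    cases o
    · have key := smoothing_false_le.1 hle (g j) (g k) (hinj hne) (hw j hj) (hw k hk)
      simp only [Bool.false_eq_true, if_false] at h
      obtain ⟨rfl, rfl⟩ | ⟨rfl, rfl⟩ := h
      · exact ⟨g _, g _, (hg _).1, (hg _).1, key.1⟩
      · exact ⟨g j + 1, g k + 1, (hg _).2, (hg _).2, key.2⟩
    · have key := smoothing_true_le.1 hle (g j) (g k) (hinj hne) (hw j hj) (hw k hk)
      simp only [if_true] at h
      obtain ⟨rfl, rfl⟩ := h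
      exact ⟨g _, g k + 1, (hg _).1, (hg _).2, key⟩

theorem comap_closing {n n' : ℕ} {f : ℕ → ℕ} (hf : Function.Surjective f) (h0 : f 0 = 0)
    (h : ∀ v, n' ≤ v → n ≤ f v) (h' : ∀ v, n ≤ v → ∃ v', n' ≤ v' ∧ f v' = v) :
    comap f (closing n) = closing n' ⊔ ker f := by
  refine comap_eqvGen_eq hf le_sup_right (sup_le ?_ (ker_le_comap _ _)) ?_
  · change _ ≤ comap f (closing n)
    refine closing_le.2 fun v hv => ?_
    rw [comap_rel, h0]
    exact closing_le.1 le_rfl _ (h v hv)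
  · rintro _ v ⟨rfl, hv⟩
    obtain ⟨v', hv', rfl⟩ := h' v hv
    exact ⟨0, v', h0, rfl, closing_le.1 le_sup_left v' hv'⟩

/-- The smoothing of the signed chord `a` with a given marker: it respects the orientation if the
marker agrees with the sign. -/
def markerSmoothing (w : List (ℕ × ℤˣ)) (a : ℕ × ℤˣ) (μ : Bool) : Setoid ℕ :=
  smoothing w a (decide (μ = true ↔ a.2 = 1))

/-- The unnormalized Kauffman state sum of a word, in which every circle counts. -/
noncomputable def wordState {R : Type*} [CommRing R] (A B d : R) (w : List (ℕ × ℤˣ)) : R :=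
  stateSum A B d w.toFinset (markerSmoothing w) (closing w.length)

end Words

/-! ### The Jones polynomial in terms of the state sum -/

namespace LongPseudolinkDiagram

open Setoid

/-- The circles of a state are the classes of the arcs of its word. -/
theorem circles_eq (P : LongPseudolinkDiagram) (S : Finset (ℕ × ℤˣ)) :
    P.circles S = (closing P.word.length ⊔
      P.word.toFinset.sup fun a => markerSmoothing P.word a (decide (a ∈ S))).numClasses := by
  set n := P.word.length with hn
  set st := closing n ⊔
    P.word.toFinset.sup fun a => markerSmoothing P.word a (decide (a ∈ S)) with hst
  let q : ℕ → Quot (P.Joined S) := fun u => Quot.mk _ ⟨min u n, by omega⟩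
  have hq : Function.Surjective q := by
    intro x
    induction x using Quot.inductionOn with
    | h x =>
      refine ⟨x.1, congrArg _ (Fin.ext ?_)⟩
      have := x.2
      simp only
      omega
  have hclose := closing_le.1 (le_sup_left : closing n ≤ st)
  have hmarker : ∀ a ∈ P.word, markerSmoothing P.word a (decide (a ∈ S)) ≤ st := fun a ha =>
    (Finset.le_sup (f := fun a => markerSmoothing P.word a (decide (a ∈ S)))
      (List.mem_toFinset.2 ha)).trans le_sup_right
  have hker : ker q = st := by
    apply le_antisymm
    · have hmin : ∀ u, st u (min u n : ℕ) := by
        intro u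
        by_cases hu : u ≤ n
        · rw [min_eq_left hu]
        · rw [min_eq_right (by omega)]
          exact st.trans' (st.symm' (hclose u (by omega))) (hclose n le_rfl)
      have hj : Relation.EqvGen.setoid (P.Joined S) ≤ comap Fin.val st := by
        refine eqvGen_le fun x y hxy => ?_
        rw [comap_rel]
        cases hxy with
        | closure => exact hclose n le_rfl
        | oriented j k hne heq h =>
          have hm := hmarker (P.word.get j) (List.get_mem _ _)
          simp only [markerSmoothing, decide_eq_true_eq, h, decide_true] at hm
          refine smoothing_true_le.1 hm j k (fun h => hne (Fin.ext h)) ?_ ?_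
          · simp
          · simpa using heq.symm
        | unorientedIn j k hne heq h =>
          have hm := hmarker (P.word.get j) (List.get_mem _ _)
          simp only [markerSmoothing, decide_eq_true_eq, h, decide_false] at hm
          refine (smoothing_false_le.1 hm j k (fun h => hne (Fin.ext h)) ?_ ?_).1
          · simp
          · simpa using heq.symm
        | unorientedOut j k hne heq h =>
          have hm := hmarker (P.word.get j) (List.get_mem _ _)
          simp only [markerSmoothing, decide_eq_true_eq, h, decide_false] at hm
          refine (smoothing_false_le.1 hm j k (fun h => hne (Fin.ext h)) ?_ ?_).2
          · simp
          · simpa using heq.symm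
      intro u v huv
      have h := hj (Quot.eqvGen_exact (ker_def.1 huv))
      exact st.trans' (hmin u) (st.trans' h (st.symm' (hmin v)))
    · refine sup_le (closing_le.2 fun v hv => ?_) (Finset.sup_le fun a ha => ?_)
      · rw [ker_def]
        refine Quot.sound ?_
        have h0 : (⟨min 0 n, by omega⟩ : Fin (n + 1)) = 0 := Fin.ext (by simp)
        have h1 : (⟨min v n, by omega⟩ : Fin (n + 1)) = Fin.last n := Fin.ext (by simp [hv])
        rw [h0, h1]
        exact Joined.closure
      · have key : ∀ j : ℕ, P.word[j]? = some a → ∃ i : Fin n, (i : ℕ) = j ∧ P.word.get i = a ∧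
            q j = Quot.mk _ i.castSucc ∧ q (j + 1) = Quot.mk _ i.succ := by
          intro j hj
          obtain ⟨h, h'⟩ := List.getElem?_eq_some_iff.1 hj
          refine ⟨⟨j, h⟩, rfl, h', congrArg _ (Fin.ext ?_), congrArg _ (Fin.ext ?_)⟩
          · simp only [Fin.val_castSucc]
            omega
          · simp only [Fin.val_succ]
            omega
        by_cases ho : a ∈ S ↔ a.2 = 1
        · simp only [markerSmoothing, decide_eq_true_eq, ho, decide_true]
          refine smoothing_true_le.2 fun j k hne hj hk => ?_
          obtain ⟨j, rfl, hja, hj1, hj2⟩ := key j hj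
          obtain ⟨k, rfl, hka, hk1, hk2⟩ := key k hk
          rw [ker_def, hj1, hk2]
          exact Quot.sound (.oriented j k (fun h => hne (h ▸ rfl)) (hja.trans hka.symm)
            (hja.symm ▸ ho))
        · simp only [markerSmoothing, decide_eq_true_eq, ho, decide_false]
          refine smoothing_false_le.2 fun j k hne hj hk => ?_
          obtain ⟨j, rfl, hja, hj1, hj2⟩ := key j hj
          obtain ⟨k, rfl, hka, hk1, hk2⟩ := key k hk
          rw [ker_def, ker_def, hj1, hk1, hj2, hk2]
          exact ⟨Quot.sound (.unorientedIn j k (fun h => hne (h ▸ rfl)) (hja.trans hka.symm)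
            (hja.symm ▸ ho)), Quot.sound (.unorientedOut j k (fun h => hne (h ▸ rfl))
            (hja.trans hka.symm) (hja.symm ▸ ho))⟩
  rw [circles, ← hker, numClasses, Nat.card_congr (quotientKerEquivOfSurjective q hq)]

/-- The value of a circle. -/
noncomputable def circleValue : ℤ[T;T⁻¹] := -powA 2 - powA (-2)

theorem powA_add (k l : ℤ) : powA (k + l) = powA k * powA l := by
  rw [powA, powA, powA, ← LaurentPolynomial.T_add, neg_add]

theorem powA_zero : powA 0 = 1 := by simp [powA]

theorem powA_mul_powA_neg : powA 1 * powA (-1) = 1 := by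
  rw [← powA_add, add_neg_cancel, powA_zero]

theorem powA_natCast (k : ℕ) : powA k = powA 1 ^ k := by
  induction k with
  | zero => simp [powA_zero]
  | succ k ih => rw [Nat.cast_succ, powA_add, ih, pow_succ]

theorem powA_neg_natCast (k : ℕ) : powA (-k) = powA (-1) ^ k := by
  induction k with
  | zero => simp [powA_zero]
  | succ k ih => rw [Nat.cast_succ, neg_add, powA_add, ih, pow_succ]

theorem circleValue_eq : circleValue = -powA 1 ^ 2 - powA (-1) ^ 2 := by
  rw [← powA_natCast, ← powA_neg_natCast]
  rfl

theorem circleValue_ne_zero : circleValue ≠ 0 := by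
  intro h
  have := congrArg (fun p : ℤ[T;T⁻¹] => p.coeff 2) h
  simp [circleValue, powA] at this

theorem circleValue_mul_bracket (P : LongPseudolinkDiagram) :
    circleValue * P.bracket = wordState (powA 1) (powA (-1)) circleValue P.word := by
  rw [bracket, wordState, stateSum, Finset.mul_sum]
  refine Finset.sum_congr rfl fun S _ => ?_
  have hpos : 1 ≤ P.circles S := by
    have : Finite (Quot (P.Joined S)) := Quot.finite _
    have : Nonempty (Quot (P.Joined S)) := ⟨Quot.mk _ 0⟩
    exact Nat.card_pos
  rw [← circles_eq, sub_eq_add_neg, powA_add, powA_natCast, powA_neg_natCast]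
  change circleValue * (_ * circleValue ^ _) = _
  conv_rhs => rw [← Nat.sub_add_cancel hpos, pow_succ]
  change _ = powA 1 ^ S.card * powA (-1) ^ (P.chords \ S).card * _
  ring

theorem jones_eq_of {P Q : LongPseudolinkDiagram} (hw : P.writhe = Q.writhe)
    (h : wordState (powA 1) (powA (-1)) circleValue P.word =
      wordState (powA 1) (powA (-1)) circleValue Q.word) : P.jones = Q.jones := by
  rw [← circleValue_mul_bracket, ← circleValue_mul_bracket] at h
  rw [jones, jones, hw, mul_left_cancel₀ circleValue_ne_zero h]

/-- A kink multiplies the state sum by `-A ^ (±3)`, which the writhe compensates. -/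
theorem jones_eq_of_kink {P Q : LongPseudolinkDiagram} {s : ℤˣ} (hw : Q.writhe = P.writhe + s)
    (h : wordState (powA 1) (powA (-1)) circleValue Q.word =
      -powA s ^ 3 * wordState (powA 1) (powA (-1)) circleValue P.word) : P.jones = Q.jones := by
  rw [← circleValue_mul_bracket, ← circleValue_mul_bracket] at h
  have h' : Q.bracket = -powA s ^ 3 * P.bracket :=
    mul_left_cancel₀ circleValue_ne_zero (by rw [h]; ring)
  have h3 : powA (-3 * s) * powA s ^ 3 = 1 := by
    rw [← powA_zero, show (0 : ℤ) = -3 * s + (s + s + s) by ring, powA_add, powA_add, powA_add]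
    ring
  have hs : ((Int.negOnePow (s : ℤ) : ℤˣ) : ℤ) = -1 := by
    rcases Int.units_eq_one_or s with rfl | rfl <;> simp
  rw [jones, jones, h', hw, Int.negOnePow_add, mul_add, powA_add, Units.val_mul, hs, mul_neg_one,
    neg_smul, ← smul_neg]
  congr 1
  linear_combination (-powA (-3 * P.writhe) * P.bracket) * h3

end LongPseudolinkDiagram

/-! ### Renaming and the first Reidemeister move on words -/

section WordMoves

open Setoid

variable {α R : Type*} [CommRing R]

theorem getElem?_append_eq_some {u v : List α} {i : ℕ} {a : α} :
    (u ++ v)[i]? = some a ↔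
      (i < u.length ∧ u[i]? = some a) ∨ (u.length ≤ i ∧ v[i - u.length]? = some a) := by
  rw [List.getElem?_append]
  split_ifs with h
  · simp [h]
  · simp [h, not_lt.1 h]

theorem getElem?_pair_eq_some {b c : α} {i : ℕ} {a : α} :
    [b, c][i]? = some a ↔ (i = 0 ∧ b = a) ∨ (i = 1 ∧ c = a) := by
  rcases i with _ | _ | i <;> simp

theorem getElem?_ne_some {u : List α} {a : α} (h : a ∉ u) (i : ℕ) : ¬u[i]? = some a :=
  fun h' => h (List.mem_of_getElem? h')

theorem wordState_map (A B d : R) (w : List (ℕ × ℤˣ)) {f : ℕ → ℕ} (hf : Function.Injective f) :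
    wordState A B d (w.map fun a => (f a.1, a.2)) = wordState A B d w := by
  have hF : Function.Injective fun a : ℕ × ℤˣ => (f a.1, a.2) := by
    rintro ⟨a, s⟩ ⟨b, t⟩ h
    simp only [Prod.mk.injEq] at h
    exact Prod.ext (hf h.1) h.2
  have himage : (w.map fun a => (f a.1, a.2)).toFinset =
      w.toFinset.image fun a => (f a.1, a.2) := by
    ext b
    simp
  rw [wordState, himage, stateSum_image A B d hF, List.length_map, wordState]
  refine stateSum_congr _ _ _ (fun a _ μ => smoothing_congr (fun i => ?_) _) _
  rw [List.getElem?_map]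
  constructor
  · intro h
    obtain ⟨b, hb, hab⟩ := Option.map_eq_some_iff.1 h
    rw [hb, hF hab]
  · intro h
    rw [h]
    rfl

/-- The crossing `a` of a word splits the state sum into two terms; the marker that respects the
orientation is the one of the sign of `a`. -/
theorem stateSum_insert_markerSmoothing (A B d : R) {T : Finset (ℕ × ℤˣ)} {a : ℕ × ℤˣ}
    (ha : a ∉ T) (w : List (ℕ × ℤˣ)) (r : Setoid ℕ) :
    stateSum A B d (insert a T) (markerSmoothing w) r =
      (if a.2 = 1 then A else B) * stateSum A B d T (markerSmoothing w) (r ⊔ smoothing w a true) +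
      (if a.2 = 1 then B else A) *
        stateSum A B d T (markerSmoothing w) (r ⊔ smoothing w a false) := by
  rw [stateSum_insert _ _ _ ha]
  by_cases h : a.2 = 1
  · simp [markerSmoothing, h]
  · simp [markerSmoothing, h, add_comm]

theorem eliminates_markerSmoothing (A B d : R) {T : Finset (ℕ × ℤˣ)} {w : List (ℕ × ℤˣ)} {i : ℕ}
    {b c : ℕ × ℤˣ} (hb : w[i]? = some b) (hc : w[i + 1]? = some c) (hbT : b ∉ T) (hcT : c ∉ T) :
    Eliminates (fun r => stateSum A B d T (markerSmoothing w) (closing w.length ⊔ r)) d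
      (i + 1) := by
  have := finite_quotient_closing w.length
  have hlt : i + 1 < w.length := (List.getElem?_eq_some_iff.1 hc).1
  refine eliminates_stateSum A B d (closing_isolates (by omega) hlt) fun a ha μ => ?_
  refine smoothing_isolates ?_ ?_ _
  · rw [hc]
    rintro ⟨⟩
    exact hcT ha
  · intro j hj
    obtain rfl : j = i := by omega
    rw [hb]
    rintro ⟨⟩
    exact hbT ha

/-- The state sum of `w` can be computed in a longer word `w'` from the chords of `w` alone, once
the additional arcs are collapsed by joining them along the fibres of `f`. -/
theorem wordState_eq_of_collapse (A B d : R) {w w' : List (ℕ × ℤˣ)} {f g : ℕ → ℕ}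
    (h0 : f 0 = 0) (hg : ∀ j, f (g j) = j ∧ f (g j + 1) = j + 1)
    (hw : ∀ a ∈ w, ∀ j, w[j]? = some a → w'[g j]? = some a)
    (hw' : ∀ a ∈ w, ∀ k, w'[k]? = some a → ∃ j, k = g j ∧ w[j]? = some a)
    (hlen : ∀ v, w'.length ≤ v → w.length ≤ f v)
    (hlen' : ∀ v, w.length ≤ v → ∃ v', w'.length ≤ v' ∧ f v' = v) :
    stateSum A B d w.toFinset (markerSmoothing w') (closing w'.length ⊔ ker f) =
      wordState A B d w := by
  have hf : Function.Surjective f := fun j => ⟨g j, (hg j).1⟩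
  refine stateSum_comap A B d hf (fun a ha μ => ?_) (comap_closing hf h0 hlen hlen')
  have ha' := List.mem_toFinset.1 ha
  exact comap_smoothing hf hg (hw a ha') (hw' a ha') _

/-- A relation below the kernel of `f` is the kernel if every point is related to some `h (f u)`. -/
theorem ker_eq_of_retract {f h : ℕ → ℕ} {s : Setoid ℕ} (hle : s ≤ ker f)
    (hh : ∀ u, s u (h (f u))) : ker f = s := by
  refine le_antisymm (fun u v huv => ?_) hle
  have := hh v
  rw [← ker_def.1 huv] at this
  exact s.trans' (hh u) (s.symm' this)

/-- First Reidemeister move. -/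
theorem wordState_kink {A B d : R} (hAB : A * B = 1) (hd : d = -A ^ 2 - B ^ 2)
    {x y : List (ℕ × ℤˣ)} {a : ℕ × ℤˣ} (hx : a ∉ x) (hy : a ∉ y) :
    wordState A B d (x ++ [a, a] ++ y) =
      -(if a.2 = 1 then A else B) ^ 3 * wordState A B d (x ++ y) := by
  set w' := x ++ [a, a] ++ y with hw'
  have hocc : ∀ i, w'[i]? = some a ↔ i = x.length ∨ i = x.length + 1 := by
    intro i
    simp only [hw', getElem?_append_eq_some, getElem?_pair_eq_some, getElem?_ne_some hx,
      getElem?_ne_some hy, List.length_append, List.length_cons, List.length_nil, and_false,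
      or_false, false_or, and_true]
    omega
  have hother : ∀ b, b ≠ a → ∀ i, w'[i]? = some b ↔
      (i < x.length ∧ x[i]? = some b) ∨
        (x.length + 2 ≤ i ∧ y[i - (x.length + 2)]? = some b) := by
    intro b hb i
    simp [hw', getElem?_append_eq_some, getElem?_pair_eq_some, hb.symm, -List.append_assoc]
    grind
  have hT : w'.toFinset = insert a (x ++ y).toFinset := by
    ext b
    simp [hw']
  have haT : a ∉ (x ++ y).toFinset := by simp [hx, hy]
  have h1 := (hocc x.length).2 (.inl rfl)
  have h2 := (hocc (x.length + 1)).2 (.inr rfl)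
  have helim := eliminates_markerSmoothing A B d h1 h2 haT haT
  have hcollapse := wordState_eq_of_collapse A B d (w := x ++ y) (w' := w')
    (f := fun u => if u ≤ x.length then u else if u ≤ x.length + 2 then x.length else u - 2)
    (g := fun j => if j < x.length then j else j + 2) (by simp)
    (by intro j; constructor <;> split_ifs <;> omega)
    (by
      intro b hb j hj
      have hba : b ≠ a := fun h => haT (h ▸ List.mem_toFinset.2 hb)
      rw [hother b hba]
      rcases getElem?_append_eq_some.1 hj with ⟨h, h'⟩ | ⟨h, h'⟩
      · left
        simpa only [h, if_true, true_and] using h'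
      · right
        simp only [not_lt.2 h, if_false]
        exact ⟨by omega, by rw [← h']; congr 1; omega⟩)
    (by
      intro b hb k hk
      have hba : b ≠ a := fun h => haT (h ▸ List.mem_toFinset.2 hb)
      rcases (hother b hba k).1 hk with ⟨h, h'⟩ | ⟨h, h'⟩
      · exact ⟨k, by simp [h], getElem?_append_eq_some.2 (.inl ⟨h, h'⟩)⟩
      · refine ⟨k - 2, ?_, getElem?_append_eq_some.2 (.inr ⟨by omega, ?_⟩)⟩
        · split_ifs <;> omega
        · rw [← h']; congr 1; omega)
    (by
      intro v hv
      simp only [hw', List.length_append, List.length_cons, List.length_nil] at hv ⊢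
      split_ifs <;> omega)
    (by
      intro v hv
      simp only [hw', List.length_append, List.length_cons, List.length_nil] at hv ⊢
      refine ⟨v + 2, by omega, ?_⟩
      split_ifs <;> omega)
  have hker : ker (fun u => if u ≤ x.length then u else if u ≤ x.length + 2 then x.length
      else u - 2) = join x.length (x.length + 2) ⊔ join x.length (x.length + 1) := by
    refine ker_eq_of_retract (h := fun u => if u ≤ x.length then u else u + 2) ?_ fun u => ?_
    · simp [join_le, ker_def]
    · have e1 := join_le.1 (le_sup_left :
        _ ≤ join x.length (x.length + 2) ⊔ join x.length (x.length + 1))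
      have e2 := join_le.1 (le_sup_right :
        _ ≤ join x.length (x.length + 2) ⊔ join x.length (x.length + 1))
      rcases lt_trichotomy u (x.length + 1) with h | rfl | h
      · simp [Nat.lt_succ_iff.1 h]
      · simpa using symm' _ e2
      · rcases Nat.lt_or_ge (x.length + 2) u with h' | h'
        · have h3 : ¬u ≤ x.length := by omega
          have h4 : ¬u ≤ x.length + 2 := by omega
          have h5 : ¬u - 2 ≤ x.length := by omega
          have h6 : u - 2 + 2 = u := by omega
          simp [h3, h4, h5, h6]
        · obtain rfl : u = x.length + 2 := by omega
          simpa using symm' _ e1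
  rw [hker] at hcollapse
  rw [wordState, hT, stateSum_insert_markerSmoothing _ _ _ haT,
    smoothing_true_eq (by omega) hocc, smoothing_false_eq (by omega) hocc, ← hcollapse]
  by_cases hs : a.2 = 1
  · simp only [hs, if_true]
    exact kink_eval hAB hd helim (by omega) (by omega)
  · simp only [hs, if_false]
    exact kink_eval (mul_comm A B ▸ hAB) (by rw [hd]; ring) helim (by omega) (by omega)

end WordMoves

/-! ### The second Reidemeister move on words -/

section WordMoves

open Setoid

variable {R : Type*} [CommRing R]

theorem getElem?_two_pairs {α : Type*} {x y z : List α} {a b c e t : α}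
    {p q i : ℕ} (hp : p = x.length) (hq : q = x.length + 2 + y.length) :
    (x ++ [a, b] ++ y ++ [c, e] ++ z)[i]? = some t ↔
      (i < p ∧ x[i]? = some t) ∨ (i = p ∧ a = t) ∨ (i = p + 1 ∧ b = t) ∨
      (p + 2 ≤ i ∧ i < q ∧ y[i - (p + 2)]? = some t) ∨ (i = q ∧ c = t) ∨ (i = q + 1 ∧ e = t) ∨
      (q + 2 ≤ i ∧ z[i - (q + 2)]? = some t) := by
  simp only [getElem?_append_eq_some, getElem?_pair_eq_some, List.length_append,
    List.length_cons, List.length_nil]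
  rw [← hp, show p + (0 + 1 + 1) + y.length = q by omega,
    show p + (0 + 1 + 1) = p + 2 by omega, show q + (0 + 1 + 1) = q + 2 by omega]
  have hpq : p + 2 ≤ q := by omega
  generalize (x[i]? = some t) = X
  generalize (y[i - (p + 2)]? = some t) = Y
  generalize (z[i - (q + 2)]? = some t) = Z
  generalize (a = t) = A
  generalize (b = t) = B
  generalize (c = t) = C
  generalize (e = t) = E
  clear hp hq
  grind

theorem getElem?_three_pairs {α : Type*} {x y z v : List α} {a a' b b' c c' t : α} {p q r i : ℕ}
    (hp : p = x.length) (hq : q = x.length + 2 + y.length)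
    (hr : r = x.length + 2 + y.length + 2 + z.length) :
    (x ++ [a, a'] ++ y ++ [b, b'] ++ z ++ [c, c'] ++ v)[i]? = some t ↔
      (i < p ∧ x[i]? = some t) ∨ (i = p ∧ a = t) ∨ (i = p + 1 ∧ a' = t) ∨
      (p + 2 ≤ i ∧ i < q ∧ y[i - (p + 2)]? = some t) ∨ (i = q ∧ b = t) ∨ (i = q + 1 ∧ b' = t) ∨
      (q + 2 ≤ i ∧ i < r ∧ z[i - (q + 2)]? = some t) ∨ (i = r ∧ c = t) ∨ (i = r + 1 ∧ c' = t) ∨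
      (r + 2 ≤ i ∧ v[i - (r + 2)]? = some t) := by
  have hlen : (x ++ [a, a'] ++ y ++ [b, b'] ++ z).length = r := by
    simp [hr]
    omega
  rw [List.append_assoc _ _ v, getElem?_append_eq_some, getElem?_two_pairs hp hq,
    getElem?_append_eq_some, getElem?_pair_eq_some, hlen]
  have hpq : p + 2 ≤ q := by omega
  have hqr : q + 2 ≤ r := by omega
  rw [show i - r - [c, c'].length = i - (r + 2) by simp; omega, show [c, c'].length = 2 from rfl]
  generalize (x[i]? = some t) = X
  generalize (y[i - (p + 2)]? = some t) = Y
  generalize (z[i - (q + 2)]? = some t) = Z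
  generalize (v[i - (r + 2)]? = some t) = V
  generalize (a = t) = A
  generalize (a' = t) = A'
  generalize (b = t) = B
  generalize (b' = t) = B'
  generalize (c = t) = C
  generalize (c' = t) = C'
  clear hp hq hr hlen
  rcases lt_or_ge i r with h | h
  · have h1 : ¬r ≤ i := by omega
    have h2 : i ≠ r := by omega
    have h3 : i ≠ r + 1 := by omega
    have h4 : ¬r + 2 ≤ i := by omega
    simp only [h, h1, h2, h3, h4, false_and, or_false, true_and]
  · have h1 : ¬i < r := by omega
    have h2 : ¬i < p := by omega
    have h3 : i ≠ p := by omega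
    have h4 : i ≠ p + 1 := by omega
    have h5 : ¬i < q := by omega
    have h6 : i ≠ q := by omega
    have h7 : i ≠ q + 1 := by omega
    simp only [h, h1, h2, h3, h4, h5, h6, h7, false_and, false_or, true_and, and_false]
    grind

/-- The two new pairs of letters of a second Reidemeister move can be removed from a word, if the
arcs `p, p + 1, p + 2` along the first pair are joined to each other, and those along the second
pair as well. -/
theorem wordState_eq_of_two_collapses (A B d : R) {x y z : List (ℕ × ℤˣ)} {a b c e : ℕ × ℤˣ}
    (h : ∀ t ∈ x ++ y ++ z, t ≠ a ∧ t ≠ b ∧ t ≠ c ∧ t ≠ e) {p q : ℕ} (hp : p = x.length)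
    (hq : q = x.length + 2 + y.length) :
    stateSum A B d (x ++ y ++ z).toFinset (markerSmoothing (x ++ [a, b] ++ y ++ [c, e] ++ z))
      (closing (x ++ [a, b] ++ y ++ [c, e] ++ z).length ⊔
        (join p (p + 2) ⊔ join p (p + 1) ⊔ (join q (q + 2) ⊔ join q (q + 1)))) =
      wordState A B d (x ++ y ++ z) := by
  set w' := x ++ [a, b] ++ y ++ [c, e] ++ z with hw'
  have hlen : w'.length = q + 2 + z.length := by
    simp [hw', hq]
    omega
  have hlen' : (x ++ y ++ z).length = q - 2 + z.length := by
    simp [hq]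
    omega
  have hother : ∀ t ∈ x ++ y ++ z, ∀ i, w'[i]? = some t ↔
      (i < p ∧ x[i]? = some t) ∨ (p + 2 ≤ i ∧ i < q ∧ y[i - (p + 2)]? = some t) ∨
        (q + 2 ≤ i ∧ z[i - (q + 2)]? = some t) := by
    intro t ht i
    obtain ⟨h1, h2, h3, h4⟩ := h t ht
    simp only [hw', getElem?_two_pairs hp hq, h1.symm, h2.symm, h3.symm, h4.symm, and_false,
      false_or]
  have hshort : ∀ t i, (x ++ y ++ z)[i]? = some t ↔
      (i < p ∧ x[i]? = some t) ∨ (p ≤ i ∧ i < q - 2 ∧ y[i - p]? = some t) ∨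
        (q - 2 ≤ i ∧ z[i - (q - 2)]? = some t) := by
    intro t i
    simp only [getElem?_append_eq_some, List.length_append]
    rw [← hp, show p + y.length = q - 2 by omega]
    grind
  have hpq : p + 2 ≤ q := by omega
  -- `f` collapses the arcs along both pairs, and `g` maps the positions of `x ++ y ++ z` to those
  -- of the longer word. If `y` is empty, then `q = p + 2`, and `f` collapses all five new arcs.
  obtain ⟨f, f₁, f₂, f₃, f₄, f₅⟩ : ∃ f : ℕ → ℕ, (∀ u, u ≤ p → f u = u) ∧
      (∀ u, p ≤ u → u ≤ p + 2 → f u = p) ∧ (∀ u, p + 2 ≤ u → u ≤ q → f u = u - 2) ∧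
      (∀ u, q ≤ u → u ≤ q + 2 → f u = q - 2) ∧ ∀ u, q + 2 ≤ u → f u = u - 4 := by
    refine ⟨fun u => if u ≤ p then u else if u ≤ p + 2 then p else if u ≤ q then u - 2 else
      if u ≤ q + 2 then q - 2 else u - 4, ?_, ?_, ?_, ?_, ?_⟩ <;>
      intros <;> dsimp only <;> split_ifs <;> omega
  obtain ⟨g, g₁, g₂, g₃⟩ : ∃ g : ℕ → ℕ, (∀ j, j < p → g j = j) ∧
      (∀ j, p ≤ j → j < q - 2 → g j = j + 2) ∧ ∀ j, q - 2 ≤ j → g j = j + 4 := by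
    refine ⟨fun j => if j < p then j else if j < q - 2 then j + 2 else j + 4, ?_, ?_, ?_⟩ <;>
      intros <;> dsimp only <;> split_ifs <;> omega
  have hcollapse := wordState_eq_of_collapse A B d (w := x ++ y ++ z) (w' := w')
    (f := f) (g := g) (f₁ 0 (by omega))
    (by
      intro j
      rcases lt_or_ge j p with h | h
      · rw [g₁ j h, f₁ j (by omega), f₁ (j + 1) (by omega)]
        exact ⟨rfl, rfl⟩
      rcases lt_or_ge j (q - 2) with h' | h'
      · rw [g₂ j h h', f₃ (j + 2) (by omega) (by omega), f₃ (j + 2 + 1) (by omega) (by omega)]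
        omega
      · rw [g₃ j h', f₅ (j + 4 + 1) (by omega)]
        rcases eq_or_lt_of_le h' with rfl | h''
        · rw [f₄ _ (by omega) (by omega)]
          omega
        · rw [f₅ _ (by omega)]
          omega)
    (by
      intro t ht j hj
      rw [hother t ht]
      rcases (hshort t j).1 hj with ⟨h, h'⟩ | ⟨h1, h2, h'⟩ | ⟨h, h'⟩
      · rw [g₁ j h]
        exact .inl ⟨h, h'⟩
      · rw [g₂ j h1 h2]
        exact .inr (.inl ⟨by omega, by omega, by rw [← h']; congr 1; omega⟩)
      · rw [g₃ j h]
        exact .inr (.inr ⟨by omega, by rw [← h']; congr 1; omega⟩))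
    (by
      intro t ht k hk
      rcases (hother t ht k).1 hk with ⟨h, h'⟩ | ⟨h1, h2, h'⟩ | ⟨h, h'⟩
      · exact ⟨k, (g₁ k h).symm, (hshort t k).2 (.inl ⟨h, h'⟩)⟩
      · refine ⟨k - 2, ?_, (hshort t _).2 (.inr (.inl ⟨by omega, by omega, ?_⟩))⟩
        · rw [g₂ _ (by omega) (by omega)]
          omega
        · rw [← h']; congr 1; omega
      · refine ⟨k - 4, ?_, (hshort t _).2 (.inr (.inr ⟨by omega, ?_⟩))⟩
        · rw [g₃ _ (by omega)]
          omega
        · rw [← h']; congr 1; omega)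
    (by
      intro v hv
      rw [hlen] at hv
      rw [hlen', f₅ v (by omega)]
      omega)
    (by
      intro v hv
      rw [hlen'] at hv
      rw [hlen]
      exact ⟨v + 4, by omega, f₅ _ (by omega)⟩)
  rw [← hcollapse]
  congr 2
  symm
  set s := join p (p + 2) ⊔ join p (p + 1) ⊔ (join q (q + 2) ⊔ join q (q + 1)) with hs
  have hle := le_refl s
  conv_lhs at hle => rw [hs]
  simp only [sup_le_iff, join_le] at hle
  obtain ⟨⟨e1, e2⟩, e3, e4⟩ := hle
  -- A section of `f` on the classes of `s`.
  obtain ⟨h, h₁, h₂, h₃⟩ : ∃ h : ℕ → ℕ, (∀ v, v ≤ p → h v = v) ∧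
      (∀ v, p < v → v ≤ q - 2 → h v = v + 2) ∧ ∀ v, q - 2 < v → h v = v + 4 := by
    refine ⟨fun v => if v ≤ p then v else if v ≤ q - 2 then v + 2 else v + 4, ?_, ?_, ?_⟩ <;>
      intros <;> dsimp only <;> split_ifs <;> omega
  refine ker_eq_of_retract (h := h) ?_ fun u => ?_
  · simp only [hs, sup_le_iff, join_le, ker_def]
    rw [f₁ p le_rfl, f₂ (p + 2) (by omega) le_rfl, f₂ (p + 1) (by omega) (by omega),
      f₄ q le_rfl (by omega), f₄ (q + 2) (by omega) le_rfl, f₄ (q + 1) (by omega) (by omega)]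
    simp
  · have cases : u ≤ p ∨ u = p + 1 ∨ u = p + 2 ∨ (p + 2 < u ∧ u ≤ q) ∨ u = q + 1 ∨ u = q + 2 ∨
        q + 2 < u := by omega
    have hq' : ∀ v, s q v → s v (h (q - 2)) := by
      intro v hv
      rcases eq_or_lt_of_le hpq with rfl | hlt
      · rw [h₁ _ (by omega)]
        exact s.symm' (s.trans' e1 hv)
      · rw [h₂ _ (by omega) le_rfl, Nat.sub_add_cancel (by omega)]
        exact s.symm' hv
    rcases cases with h' | rfl | rfl | ⟨h', h''⟩ | rfl | rfl | h'
    · rw [f₁ u h', h₁ u h']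
    · rw [f₂ _ (by omega) (by omega), h₁ p le_rfl]
      exact s.symm' e2
    · rw [f₂ _ (by omega) le_rfl, h₁ p le_rfl]
      exact s.symm' e1
    · rw [f₃ u (by omega) h'', h₂ _ (by omega) (by omega), Nat.sub_add_cancel (by omega)]
    · rw [f₄ _ (by omega) (by omega)]
      exact hq' _ e4
    · rw [f₄ _ (by omega) le_rfl]
      exact hq' _ e3
    · rw [f₅ u (by omega), h₃ _ (by omega), Nat.sub_add_cancel (by omega)]

/-- Second Reidemeister move; the strands have the same direction if `c = a`, and opposite
directions if `c = b`. -/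
theorem wordState_bigon [IsDomain R] {A B d : R} (hAB : A * B = 1) (hd : d = -A ^ 2 - B ^ 2)
    (hd0 : d ≠ 0) {x y z : List (ℕ × ℤˣ)} {a b c e : ℕ × ℤˣ} (hab : a.2 = -b.2)
    (hce : (c = a ∧ e = b) ∨ (c = b ∧ e = a)) (ha : a ∉ x ++ y ++ z) (hb : b ∉ x ++ y ++ z) :
    wordState A B d (x ++ [a, b] ++ y ++ [c, e] ++ z) = wordState A B d (x ++ y ++ z) := by
  have hne : a ≠ b := by
    rintro rfl
    exact units_ne_neg_self _ hab
  obtain ⟨p, hp⟩ : ∃ p, p = x.length := ⟨_, rfl⟩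
  obtain ⟨q, hq⟩ : ∃ q, q = x.length + 2 + y.length := ⟨_, rfl⟩
  rw [← wordState_eq_of_two_collapses A B d (a := a) (b := b) (c := c) (e := e)
    (fun t ht => by
      have h1 : t ≠ a := fun h => ha (h ▸ ht)
      have h2 : t ≠ b := fun h => hb (h ▸ ht)
      rcases hce with ⟨rfl, rfl⟩ | ⟨rfl, rfl⟩ <;> exact ⟨by assumption, by assumption,
        by assumption, by assumption⟩) hp hq]
  have haT : a ∉ (x ++ y ++ z).toFinset := fun h => ha (List.mem_toFinset.1 h)
  have hbT : b ∉ (x ++ y ++ z).toFinset := fun h => hb (List.mem_toFinset.1 h)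
  have haT' : a ∉ insert b (x ++ y ++ z).toFinset := by
    rw [Finset.mem_insert, not_or]
    exact ⟨hne, haT⟩
  simp only [List.mem_append, not_or] at ha hb
  have signs : (a.2 = 1 ∧ b.2 = -1) ∨ (a.2 = -1 ∧ b.2 = 1) := by
    rcases Int.units_eq_one_or b.2 with h | h
    · exact .inr ⟨by rw [hab, h], h⟩
    · exact .inl ⟨by rw [hab, h, neg_neg], h⟩
  have hneg : ¬(-1 : ℤˣ) = 1 := by decide
  set w' := x ++ [a, b] ++ y ++ [c, e] ++ z with hw'
  have hT : w'.toFinset = insert a (insert b (x ++ y ++ z).toFinset) := by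
    ext t
    rcases hce with ⟨rfl, rfl⟩ | ⟨rfl, rfl⟩
    all_goals
      simp only [hw', List.mem_toFinset, List.mem_append, Finset.mem_insert, List.mem_cons,
        List.not_mem_nil]
      tauto
  have occ : ∀ t i, w'[i]? = some t ↔ _ := fun t i => getElem?_two_pairs hp hq
  have hwa := (occ a p).2 (.inr (.inl ⟨rfl, rfl⟩))
  have hwb := (occ b (p + 1)).2 (.inr (.inr (.inl ⟨rfl, rfl⟩)))
  have hwc := (occ c q).2 (by simp)
  have hwe := (occ e (q + 1)).2 (by simp)
  have h₀ := eliminates_markerSmoothing A B d hwa hwb haT hbT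
  have h₁ := eliminates_markerSmoothing A B d (T := (x ++ y ++ z).toFinset) hwc hwe
    (by rcases hce with ⟨rfl, rfl⟩ | ⟨rfl, rfl⟩ <;> assumption)
    (by rcases hce with ⟨rfl, rfl⟩ | ⟨rfl, rfl⟩ <;> assumption)
  have hq2 : p + 2 ≤ q := by omega
  rw [wordState, hT]
  simp only [stateSum_insert_markerSmoothing _ _ _ haT', stateSum_insert_markerSmoothing _ _ _ hbT,
    sup_assoc (closing _)]
  set F : Setoid ℕ → R := fun r =>
    stateSum A B d (x ++ y ++ z).toFinset (markerSmoothing w') (closing w'.length ⊔ r) with hF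
  have hF' : ∀ r, stateSum A B d (x ++ y ++ z).toFinset (markerSmoothing w')
      (closing w'.length ⊔ r) = F r := fun _ => rfl
  simp only [hF']
  clear_value F
  apply mul_left_cancel₀ (pow_ne_zero 2 hd0)
  rcases hce with ⟨rfl, rfl⟩ | ⟨rfl, rfl⟩
  · have hocca : ∀ i, w'[i]? = some c ↔ i = p ∨ i = q := by
      intro i
      simp [occ, getElem?_ne_some ha.1.1, getElem?_ne_some ha.1.2, getElem?_ne_some ha.2, hne.symm]
    have hoccb : ∀ i, w'[i]? = some e ↔ i = p + 1 ∨ i = q + 1 := by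
      intro i
      simp [occ, getElem?_ne_some hb.1.1, getElem?_ne_some hb.1.2, getElem?_ne_some hb.2, hne]
    have ends : ∀ t ∈ [p, p + 2, q, q + 2], t ≠ p + 1 ∧ t ≠ q + 1 := by
      simp only [List.mem_cons, List.not_mem_nil, or_false, forall_eq_or_imp, forall_eq]
      omega
    have key := fun A B hd => bigon_eval (A := A) (B := B) hd h₀ h₁ (by omega) ends
      (smoothing_true_eq (by omega) hocca) (smoothing_false_eq (by omega) hocca)
      (smoothing_false_eq (by omega) hoccb) (smoothing_true_eq (by omega) hoccb)
    rcases signs with ⟨h1, h2⟩ | ⟨h1, h2⟩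
    · simp only [h1, h2, hneg, if_true, if_false]
      linear_combination key A B hd + d ^ 2 * hAB * (F (smoothing w' c true ⊔ smoothing w' e true) +
        F (smoothing w' c false ⊔ smoothing w' e false))
    · simp only [h1, h2, hneg, if_true, if_false]
      linear_combination key B A (by rw [hd]; ring) + d ^ 2 * hAB *
        (F (smoothing w' c true ⊔ smoothing w' e true) +
        F (smoothing w' c false ⊔ smoothing w' e false))
  · have hocca : ∀ i, w'[i]? = some e ↔ i = p ∨ i = q + 1 := by
      intro i
      simp [occ, getElem?_ne_some ha.1.1, getElem?_ne_some ha.1.2, getElem?_ne_some ha.2, hne.symm]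
    have hoccb : ∀ i, w'[i]? = some c ↔ i = p + 1 ∨ i = q := by
      intro i
      simp [occ, getElem?_ne_some hb.1.1, getElem?_ne_some hb.1.2, getElem?_ne_some hb.2, hne]
    have ends : ∀ t ∈ [p, p + 2, q + 2, q], t ≠ p + 1 ∧ t ≠ q + 1 := by
      simp only [List.mem_cons, List.not_mem_nil, or_false, forall_eq_or_imp, forall_eq]
      omega
    -- With the second strand read backwards this is the case of parallel strands, except that the
    -- smoothings that respect the orientation and those that do not trade places.
    have key := fun A B hd => bigon_eval (A := A) (B := B) hd h₀ h₁ (by omega) ends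
      ((smoothing_false_eq (by omega) hocca).trans (by
        rw [unorientedJoin, join_comm (p + 1)]))
      ((smoothing_true_eq (by omega) hocca).trans (by
        rw [orientedJoin, join_comm (q + 1)]))
      ((smoothing_true_eq (by omega) hoccb).trans (by
        rw [orientedJoin, join_comm q]))
      ((smoothing_false_eq (by omega) hoccb).trans (by
        rw [unorientedJoin, join_comm (p + 1 + 1)]))
    have hjoin : join p (p + 2) ⊔ join p (p + 1) ⊔ (join (q + 2) q ⊔ join (q + 2) (q + 1)) =
        join p (p + 2) ⊔ join p (p + 1) ⊔ (join q (q + 2) ⊔ join q (q + 1)) := by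
      refine eq_of_forall_ge_iff fun u => ?_
      simp only [sup_le_iff, join_le_iff_mk_eq]
      grind
    rw [hjoin] at key
    rcases signs with ⟨h1, h2⟩ | ⟨h1, h2⟩
    · simp only [h1, h2, hneg, if_true, if_false]
      linear_combination key B A (by rw [hd]; ring) + d ^ 2 * hAB *
        (F (smoothing w' e true ⊔ smoothing w' c true) +
        F (smoothing w' e false ⊔ smoothing w' c false))
    · simp only [h1, h2, hneg, if_true, if_false]
      linear_combination key A B hd + d ^ 2 * hAB *
        (F (smoothing w' e true ⊔ smoothing w' c true) +
        F (smoothing w' e false ⊔ smoothing w' c false))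

end WordMoves

/-! ### The third Reidemeister move on words -/

section WordMoves

open Setoid

variable {R : Type*} [CommRing R]

/-- If the strands of a crossing are read in the directions given by `f` and `g`, the smoothing that
respects the orientation and the one that does not trade places whenever exactly one strand is read
backwards. -/
theorem smoothing_beq {α : Type*} {w : List α} {t : α} {j k : ℕ} (hjk : j ≠ k)
    (h : ∀ i : ℕ, w[i]? = some t ↔ i = j ∨ i = k) (f g : Bool) :
    smoothing w t (f == g) = orientedJoin (if f then j else j + 1) (if f then j + 1 else j)
      (if g then k else k + 1) (if g then k + 1 else k) := by
  cases f <;> cases g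
  · exact (smoothing_true_eq hjk h).trans (by simp [orientedJoin, join_comm, sup_comm])
  · exact (smoothing_false_eq hjk h).trans (by
      simp [orientedJoin, unorientedJoin, join_comm, sup_comm])
  · exact (smoothing_false_eq hjk h).trans (by simp [orientedJoin, unorientedJoin, join_comm])
  · exact smoothing_true_eq hjk h

theorem smoothing_not_beq {α : Type*} {w : List α} {t : α} {j k : ℕ} (hjk : j ≠ k)
    (h : ∀ i : ℕ, w[i]? = some t ↔ i = j ∨ i = k) (f g : Bool) :
    smoothing w t (!(f == g)) = unorientedJoin (if f then j else j + 1) (if f then j + 1 else j)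
      (if g then k else k + 1) (if g then k + 1 else k) := by
  cases f <;> cases g
  · exact (smoothing_false_eq hjk h).trans (by simp [unorientedJoin, sup_comm])
  · exact (smoothing_true_eq hjk h).trans (by
      simp [orientedJoin, unorientedJoin, join_comm, sup_comm])
  · exact (smoothing_true_eq hjk h).trans (by simp [orientedJoin, unorientedJoin, join_comm])
  · exact smoothing_false_eq hjk h

/-- The state sum of a word that contains the triangle of a third Reidemeister move. The strand `i`
of the triangle begins with the arc `Pᵢ`; the chords `a`, `b`, `c` join the strands `0` and `1`,
`0` and `2`, `1` and `2`. The strand `0` meets `a` first if `f₀` holds, the strand `1` meets `a`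
first if `f₁` holds, and the strand `2` meets `b` first if `f₂` holds. -/
theorem wordState_eq_triangleValue {A B d : R} (hAB : A * B = 1) (hd : d = -A ^ 2 - B ^ 2)
    {w : List (ℕ × ℤˣ)} {T : Finset (ℕ × ℤˣ)} {a b c : ℕ × ℤˣ}
    (hT : w.toFinset = insert a (insert b (insert c T))) (ha : a ∉ T) (hb : b ∉ T) (hc : c ∉ T)
    (hab : a ≠ b) (hac : a ≠ c) (hbc : b ≠ c) {P₀ P₁ P₂ : ℕ} (h₀₁ : P₀ + 2 ≤ P₁)
    (h₁₂ : P₁ + 2 ≤ P₂) (f₀ f₁ f₂ : Bool) (ε : ℤˣ)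
    (hsa : a.2 = if f₀ = f₁ then ε else -ε) (hsb : b.2 = if f₀ = f₂ then ε else -ε)
    (hsc : c.2 = if f₁ = f₂ then ε else -ε)
    (occa : ∀ i, w[i]? = some a ↔ i = (if f₀ then P₀ else P₀ + 1) ∨ i = if f₁ then P₁ else P₁ + 1)
    (occb : ∀ i, w[i]? = some b ↔ i = (if f₀ then P₀ + 1 else P₀) ∨ i = if f₂ then P₂ else P₂ + 1)
    (occc : ∀ i, w[i]? = some c ↔
      i = (if f₁ then P₁ + 1 else P₁) ∨ i = if f₂ then P₂ + 1 else P₂) :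
    d ^ 3 * wordState A B d w =
      triangleValue (fun r => stateSum A B d T (markerSmoothing w) (closing w.length ⊔ r))
        (if ε = 1 then A else B) (if ε = 1 then B else A)
        (if f₀ then P₀ else P₀ + 2) (if f₀ then P₀ + 2 else P₀)
        (if f₁ then P₁ else P₁ + 2) (if f₁ then P₁ + 2 else P₁)
        (if f₂ then P₂ else P₂ + 2) (if f₂ then P₂ + 2 else P₂) := by
  have hneg : ¬(-1 : ℤˣ) = 1 := by decide
  -- Reading one of two crossing strands backwards changes the sign of their crossing, so all
  -- crossings have the sign `ε` once the strands are directed as in `triangle_eval`.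
  have expand : ∀ {t : ℕ × ℤˣ} {U : Finset (ℕ × ℤˣ)} {f g : Bool},
      (t.2 = if f = g then ε else -ε) → t ∉ U → ∀ r,
      stateSum A B d (insert t U) (markerSmoothing w) r =
        (if ε = 1 then A else B) *
          stateSum A B d U (markerSmoothing w) (r ⊔ smoothing w t (f == g)) +
        (if ε = 1 then B else A) *
          stateSum A B d U (markerSmoothing w) (r ⊔ smoothing w t (!(f == g))) := by
    intro t U f g ht htU r
    rw [stateSum_insert_markerSmoothing _ _ _ htU, ht]
    rcases Int.units_eq_one_or ε with rfl | rfl <;> cases f <;> cases g <;>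
      simp [hneg, add_comm]
  have hα : smoothing w a (f₀ == f₁) = orientedJoin (if f₀ then P₀ else P₀ + 2) (P₀ + 1)
      (if f₁ then P₁ else P₁ + 2) (P₁ + 1) :=
    (smoothing_beq (by split_ifs <;> omega) occa f₀ f₁).trans
      (by cases f₀ <;> cases f₁ <;> rfl)
  have hα' : smoothing w a (!(f₀ == f₁)) = unorientedJoin (if f₀ then P₀ else P₀ + 2) (P₀ + 1)
      (if f₁ then P₁ else P₁ + 2) (P₁ + 1) :=
    (smoothing_not_beq (by split_ifs <;> omega) occa f₀ f₁).trans
      (by cases f₀ <;> cases f₁ <;> rfl)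
  have hβ : smoothing w b (f₀ == f₂) = orientedJoin (P₀ + 1) (if f₀ then P₀ + 2 else P₀)
      (if f₂ then P₂ else P₂ + 2) (P₂ + 1) :=
    (smoothing_beq (by split_ifs <;> omega) occb f₀ f₂).trans
      (by cases f₀ <;> cases f₂ <;> rfl)
  have hβ' : smoothing w b (!(f₀ == f₂)) = unorientedJoin (P₀ + 1) (if f₀ then P₀ + 2 else P₀)
      (if f₂ then P₂ else P₂ + 2) (P₂ + 1) :=
    (smoothing_not_beq (by split_ifs <;> omega) occb f₀ f₂).trans
      (by cases f₀ <;> cases f₂ <;> rfl)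
  have hγ : smoothing w c (f₁ == f₂) = orientedJoin (P₁ + 1) (if f₁ then P₁ + 2 else P₁)
      (P₂ + 1) (if f₂ then P₂ + 2 else P₂) :=
    (smoothing_beq (by split_ifs <;> omega) occc f₁ f₂).trans
      (by cases f₁ <;> cases f₂ <;> rfl)
  have hγ' : smoothing w c (!(f₁ == f₂)) = unorientedJoin (P₁ + 1) (if f₁ then P₁ + 2 else P₁)
      (P₂ + 1) (if f₂ then P₂ + 2 else P₂) :=
    (smoothing_not_beq (by split_ifs <;> omega) occc f₁ f₂).trans
      (by cases f₁ <;> cases f₂ <;> rfl)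
  have elim₀ : Eliminates (fun r => stateSum A B d T (markerSmoothing w) (closing w.length ⊔ r)) d
      (P₀ + 1) := by
    cases f₀
    · exact eliminates_markerSmoothing A B d ((occb _).2 (by simp)) ((occa _).2 (by simp)) hb ha
    · exact eliminates_markerSmoothing A B d ((occa _).2 (by simp)) ((occb _).2 (by simp)) ha hb
  have elim₁ : Eliminates (fun r => stateSum A B d T (markerSmoothing w) (closing w.length ⊔ r)) d
      (P₁ + 1) := by
    cases f₁
    · exact eliminates_markerSmoothing A B d ((occc _).2 (by simp)) ((occa _).2 (by simp)) hc ha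
    · exact eliminates_markerSmoothing A B d ((occa _).2 (by simp)) ((occc _).2 (by simp)) ha hc
  have elim₂ : Eliminates (fun r => stateSum A B d T (markerSmoothing w) (closing w.length ⊔ r)) d
      (P₂ + 1) := by
    cases f₂
    · exact eliminates_markerSmoothing A B d ((occc _).2 (by simp)) ((occb _).2 (by simp)) hc hb
    · exact eliminates_markerSmoothing A B d ((occb _).2 (by simp)) ((occc _).2 (by simp)) hb hc
  have hAB' : (if ε = 1 then A else B) * (if ε = 1 then B else A) = 1 := by
    split_ifs
    · exact hAB
    · rw [mul_comm, hAB]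
  have hd' : d = -(if ε = 1 then A else B) ^ 2 - (if ε = 1 then B else A) ^ 2 := by
    split_ifs
    · exact hd
    · rw [hd]
      ring
  rw [wordState, hT, expand hsa (by simp [hab, hac, ha])]
  simp only [expand hsb (show b ∉ insert c T by simp [hbc, hb]), expand hsc hc,
    sup_assoc (closing _)]
  have ends : ∀ t ∈ [if f₀ then P₀ else P₀ + 2, if f₀ then P₀ + 2 else P₀,
      if f₁ then P₁ else P₁ + 2, if f₁ then P₁ + 2 else P₁,
      if f₂ then P₂ else P₂ + 2, if f₂ then P₂ + 2 else P₂],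
      t ≠ P₀ + 1 ∧ t ≠ P₁ + 1 ∧ t ≠ P₂ + 1 := by
    simp only [List.mem_cons, List.not_mem_nil, or_false, forall_eq_or_imp, forall_eq]
    refine ⟨?_, ?_, ?_, ?_, ?_, ?_⟩ <;> split_ifs <;> omega
  have key := triangle_eval hAB' hd' elim₀ elim₁ elim₂ (by simp; omega) ends hα hα' hβ hβ' hγ hγ'
  rw [← key]
  set F : Setoid ℕ → R := fun r =>
    stateSum A B d T (markerSmoothing w) (closing w.length ⊔ r) with hF
  have hF' : ∀ r, stateSum A B d T (markerSmoothing w) (closing w.length ⊔ r) = F r :=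
    fun _ => rfl
  simp only [hF']
  clear_value F
  clear key ends elim₀ elim₁ elim₂ hα hα' hβ hβ' hγ hγ'
  generalize (if ε = 1 then A else B) = A' at *
  generalize (if ε = 1 then B else A) = B' at *
  generalize smoothing w a (f₀ == f₁) = α
  generalize smoothing w a (!(f₀ == f₁)) = α'
  generalize smoothing w b (f₀ == f₂) = β
  generalize smoothing w b (!(f₀ == f₂)) = β'
  generalize smoothing w c (f₁ == f₂) = γ
  generalize smoothing w c (!(f₁ == f₂)) = γ'
  linear_combination d ^ 3 * hAB' *
    (A' * (F (α ⊔ β ⊔ γ') + F (α ⊔ β' ⊔ γ) + F (α' ⊔ β ⊔ γ)) +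
      B' * (F (α ⊔ β' ⊔ γ') + F (α' ⊔ β ⊔ γ') + F (α' ⊔ β' ⊔ γ)))

theorem getElem?_three_pairs_of_notMem {α : Type*} {x y z v : List α} {a a' b b' c c' t : α}
    {p q r i : ℕ} (hp : p = x.length) (hq : q = x.length + 2 + y.length)
    (hr : r = x.length + 2 + y.length + 2 + z.length) (ht : t ∉ x ++ y ++ z ++ v) :
    (x ++ [a, a'] ++ y ++ [b, b'] ++ z ++ [c, c'] ++ v)[i]? = some t ↔
      (i = p ∧ a = t) ∨ (i = p + 1 ∧ a' = t) ∨ (i = q ∧ b = t) ∨ (i = q + 1 ∧ b' = t) ∨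
      (i = r ∧ c = t) ∨ (i = r + 1 ∧ c' = t) := by
  simp only [List.mem_append, not_or] at ht
  obtain ⟨⟨⟨h1, h2⟩, h3⟩, h4⟩ := ht
  simp only [getElem?_three_pairs hp hq hr, getElem?_ne_some h1, getElem?_ne_some h2,
    getElem?_ne_some h3, getElem?_ne_some h4, and_false, or_false, false_or]

theorem union_three_pairs {α : Type*} [DecidableEq α] (x y z v : Finset α) (a b c : α) :
    x ∪ {a, b} ∪ y ∪ {a, c} ∪ z ∪ {b, c} ∪ v = insert a (insert b (insert c (x ∪ y ∪ z ∪ v))) := by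
  ext t
  simp only [Finset.mem_union, Finset.mem_insert, Finset.mem_singleton]
  grind

/-- Third Reidemeister move; all signs of the crossings `a`, `b`, `c` occur. -/
theorem wordState_triangle [IsDomain R] {A B d : R} (hAB : A * B = 1) (hd : d = -A ^ 2 - B ^ 2)
    (hd0 : d ≠ 0) {x y z v : List (ℕ × ℤˣ)} {a b c : ℕ × ℤˣ} (hab : a ≠ b) (hac : a ≠ c)
    (hbc : b ≠ c) (ha : a ∉ x ++ y ++ z ++ v) (hb : b ∉ x ++ y ++ z ++ v)
    (hc : c ∉ x ++ y ++ z ++ v) {δ : ℤˣ} {w w' : List (ℕ × ℤˣ)}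
    (hw : w = x ++ (if a.2 * b.2 = δ then [a, b] else [b, a]) ++ y ++
      (if a.2 * c.2 = δ then [a, c] else [c, a]) ++ z ++
      (if b.2 * c.2 = δ then [b, c] else [c, b]) ++ v)
    (hw' : w' = x ++ (if a.2 * b.2 = -δ then [a, b] else [b, a]) ++ y ++
      (if a.2 * c.2 = -δ then [a, c] else [c, a]) ++ z ++
      (if b.2 * c.2 = -δ then [b, c] else [c, b]) ++ v) :
    wordState A B d w = wordState A B d w' := by
  obtain ⟨P₀, hP₀⟩ : ∃ p, p = x.length := ⟨_, rfl⟩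
  obtain ⟨P₁, hP₁⟩ : ∃ p, p = x.length + 2 + y.length := ⟨_, rfl⟩
  obtain ⟨P₂, hP₂⟩ : ∃ p, p = x.length + 2 + y.length + 2 + z.length := ⟨_, rfl⟩
  have haT : a ∉ (x ++ y ++ z ++ v).toFinset := fun h => ha (List.mem_toFinset.1 h)
  have hbT : b ∉ (x ++ y ++ z ++ v).toFinset := fun h => hb (List.mem_toFinset.1 h)
  have hcT : c ∉ (x ++ y ++ z ++ v).toFinset := fun h => hc (List.mem_toFinset.1 h)
  have eval : ∀ (f₀ f₁ f₂ : Bool) (u : List (ℕ × ℤˣ)), u = x ++ (if f₀ then [a, b] else [b, a]) ++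
      y ++ (if f₁ then [a, c] else [c, a]) ++ z ++ (if f₂ then [b, c] else [c, b]) ++ v → ∀ ε : ℤˣ,
      (a.2 = if f₀ = f₁ then ε else -ε) → (b.2 = if f₀ = f₂ then ε else -ε) →
      (c.2 = if f₁ = f₂ then ε else -ε) →
      d ^ 3 * wordState A B d u =
      triangleValue (fun r => stateSum A B d (x ++ y ++ z ++ v).toFinset (markerSmoothing u)
        (closing u.length ⊔ r)) (if ε = 1 then A else B) (if ε = 1 then B else A)
        (if f₀ then P₀ else P₀ + 2) (if f₀ then P₀ + 2 else P₀)
        (if f₁ then P₁ else P₁ + 2) (if f₁ then P₁ + 2 else P₁)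
        (if f₂ then P₂ else P₂ + 2) (if f₂ then P₂ + 2 else P₂) := by
    intro f₀ f₁ f₂ u hu ε hsa hsb hsc
    refine wordState_eq_triangleValue hAB hd ?_ haT hbT hcT hab hac hbc (by omega) (by omega)
      f₀ f₁ f₂ ε hsa hsb hsc ?_ ?_ ?_
    · have hpair : ∀ (f : Bool) (s t : ℕ × ℤˣ),
          (if f then [s, t] else [t, s]).toFinset = {s, t} := by
        intro f s t
        cases f
        · simp [Finset.pair_comm]
        · simp
      simp only [hu, List.toFinset_append, hpair]
      exact union_three_pairs _ _ _ _ _ _ _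
    all_goals
      intro i
      subst hu
      cases f₀ <;> cases f₁ <;> cases f₂ <;>
        simp only [if_true, Bool.false_eq_true, if_false,
          getElem?_three_pairs_of_notMem hP₀ hP₁ hP₂ ha,
          getElem?_three_pairs_of_notMem hP₀ hP₁ hP₂ hb,
          getElem?_three_pairs_of_notMem hP₀ hP₁ hP₂ hc, hab, hac, hbc, hab.symm, hac.symm,
          hbc.symm, and_true, and_false, or_false, false_or]
  have hneg : ¬(-1 : ℤˣ) = 1 := by decide
  have hneg' : ¬(1 : ℤˣ) = -1 := by decide
  -- With these directions of the strands, all three crossings have the sign `a.2 * b.2 * c.2`; the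
  -- other side of the move has the opposite directions.
  have e := eval (decide (a.2 * b.2 = δ)) (decide (a.2 * c.2 = δ)) (decide (b.2 * c.2 = δ)) w
    (by simpa only [decide_eq_true_eq] using hw) (a.2 * b.2 * c.2)
  have e' := eval (decide (a.2 * b.2 = -δ)) (decide (a.2 * c.2 = -δ)) (decide (b.2 * c.2 = -δ)) w'
    (by simpa only [decide_eq_true_eq] using hw') (a.2 * b.2 * c.2)
  have hF : (fun r => stateSum A B d (x ++ y ++ z ++ v).toFinset (markerSmoothing w)
      (closing w.length ⊔ r)) = fun r => stateSum A B d (x ++ y ++ z ++ v).toFinset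
        (markerSmoothing w') (closing w'.length ⊔ r) := by
    have hlen : w.length = w'.length := by
      have hpair : ∀ (P : Prop) [Decidable P] (s t : ℕ × ℤˣ),
          (if P then [s, t] else [t, s]).length = 2 := by
        intro P _ s t
        split_ifs <;> rfl
      simp only [hw, hw', List.length_append, hpair]
    funext r
    rw [hlen]
    refine stateSum_congr _ _ _ (fun t ht μ => smoothing_congr (fun i => ?_) _) _
    have hta : a ≠ t := fun h => haT (h ▸ ht)
    have htb : b ≠ t := fun h => hbT (h ▸ ht)
    have htc : c ≠ t := fun h => hcT (h ▸ ht)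
    have hpair : ∀ (P : Prop) [Decidable P] (s t : ℕ × ℤˣ),
        (if P then [s, t] else [t, s]) = [if P then s else t, if P then t else s] := by
      intro P _ s t
      split_ifs <;> rfl
    have hite : ∀ (P : Prop) [Decidable P] {s s' : ℕ × ℤˣ}, s ≠ t → s' ≠ t →
        (if P then s else s') ≠ t := by
      intro P _ s s' h h'
      split_ifs <;> assumption
    simp only [hw, hw', hpair, getElem?_three_pairs hP₀ hP₁ hP₂, hite _ hta htb, hite _ htb hta,
      hite _ hta htc, hite _ htc hta, hite _ htb htc, hite _ htc htb, and_false, false_or]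
  rw [hF] at e
  generalize (fun r => stateSum A B d (x ++ y ++ z ++ v).toFinset
        (markerSmoothing w') (closing w'.length ⊔ r)) = F at *
  apply mul_left_cancel₀ (pow_ne_zero 3 hd0)
  clear eval hw hw' hF
  rcases Int.units_eq_one_or a.2 with h1 | h1 <;> rcases Int.units_eq_one_or b.2 with h2 | h2 <;>
    rcases Int.units_eq_one_or c.2 with h3 | h3 <;> rcases Int.units_eq_one_or δ with h4 | h4 <;>
    simp only [h1, h2, h3, h4, hneg, hneg', mul_one, mul_neg, neg_neg, if_true, if_false,
      decide_true, decide_false, Bool.false_eq_true, Bool.true_eq_false, forall_const] at e e' <;>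
    rw [e, e', triangleValue_reverse]

end WordMoves

/-! ### The flat word of a Gauss diagram -/

/-- Whether the first passage of the word `w` through the chord `c` is the upper one. -/
def firstOver (w : List GaussLetter) (c : ℕ) : Bool :=
  match w.find? (fun x => x.chord = c) with
  | some x => x.isOver
  | none => false

theorem firstOver_append_of_forall_ne {u v : List GaussLetter} {c : ℕ}
    (h : ∀ x ∈ u, x.chord ≠ c) : firstOver (u ++ v) c = firstOver v c := by
  have hu : u.find? (fun x => x.chord = c) = none := by simpa using h
  rw [firstOver, List.find?_append, hu, Option.none_or, firstOver]

theorem firstOver_append_append_of_forall_ne {u b v : List GaussLetter} {c : ℕ}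
    (h : ∀ x ∈ b, x.chord ≠ c) : firstOver (u ++ b ++ v) c = firstOver (u ++ v) c := by
  have hb : b.find? (fun x => x.chord = c) = none := by simpa using h
  rw [firstOver, List.find?_append, List.find?_append, hb, Option.or_none, firstOver,
    List.find?_append]

theorem firstOver_cons (x : GaussLetter) (v : List GaussLetter) (c : ℕ) :
    firstOver (x :: v) c = if x.chord = c then x.isOver else firstOver v c := by
  by_cases h : x.chord = c <;> simp [firstOver, h]

/-- The letter of the pseudolink `i (p D)` that comes from the letter `x`, where `φ` tells which
chords are first passed over. -/
def flatLetter (φ : ℕ → Bool) (x : GaussLetter) : ℕ × ℤˣ :=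
  (x.chord, if φ x.chord then x.sign else -x.sign)

/-- The word of the pseudolink `i (p D)` for the Gauss diagram `D` with the word `w`. -/
def flatWord (w : List GaussLetter) : List (ℕ × ℤˣ) := w.map (flatLetter (firstOver w))

theorem word_i_p (D : LongGaussDiagram) : (OpenFlatDiagram.i D.p).word = flatWord D.word := by
  simp only [OpenFlatDiagram.i, LongGaussDiagram.p, flatWord, List.map_map]
  refine List.map_congr_left fun x _ => ?_
  have h : D.firstIsOver x.chord = firstOver D.word x.chord := rfl
  simp only [Function.comp_apply, flatLetter, LongGaussDiagram.flatLabel, h]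
  rcases Int.units_eq_one_or x.sign with hs | hs <;>
    cases firstOver D.word x.chord <;> simp [hs, FlatLabel.toSign]

theorem map_flatLetter_congr {φ ψ : ℕ → Bool} {u : List GaussLetter}
    (h : ∀ x ∈ u, φ x.chord = ψ x.chord) : u.map (flatLetter φ) = u.map (flatLetter ψ) :=
  List.map_congr_left fun x hx => by rw [flatLetter, flatLetter, h x hx]

theorem notMem_map_flatLetter {φ : ℕ → Bool} {u : List GaussLetter} {a : ℕ × ℤˣ}
    (h : ∀ x ∈ u, x.chord ≠ a.1) : a ∉ u.map (flatLetter φ) := by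
  intro ha
  obtain ⟨x, hx, rfl⟩ := List.mem_map.1 ha
  exact h x hx rfl

theorem forall_chord_ne_of_count {u : List GaussLetter} {c : ℕ}
    (h : (u.map GaussLetter.chord).count c = 0) : ∀ x ∈ u, x.chord ≠ c := by
  intro x hx hc
  exact List.count_eq_zero.1 h (List.mem_map.2 ⟨x, hx, hc⟩)

/-! ### The strands of a third Reidemeister move -/

section Triangle

variable {c₀₁ c₀₂ c₁₂ : ℕ} {e₀₁ e₀₂ e₁₂ δ : ℤˣ} {l : List GaussLetter}

theorem firstOver_strand_zero (h : c₀₁ ≠ c₀₂) (h' : c₀₁ ≠ c₁₂) (h'' : c₀₂ ≠ c₁₂) :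
    firstOver (omegaThreeStrand c₀₁ c₀₂ c₁₂ e₀₁ e₀₂ e₁₂ δ 0 ++ l) c₀₁ = true ∧
    firstOver (omegaThreeStrand c₀₁ c₀₂ c₁₂ e₀₁ e₀₂ e₁₂ δ 0 ++ l) c₀₂ = true ∧
    firstOver (omegaThreeStrand c₀₁ c₀₂ c₁₂ e₀₁ e₀₂ e₁₂ δ 0 ++ l) c₁₂ = firstOver l c₁₂ := by
  simp only [omegaThreeStrand, Matrix.cons_val]
  split_ifs <;> simp [firstOver_cons, h, h.symm, h', h'']

theorem firstOver_strand_one (h : c₀₁ ≠ c₀₂) (h' : c₀₁ ≠ c₁₂) (h'' : c₀₂ ≠ c₁₂) :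
    firstOver (omegaThreeStrand c₀₁ c₀₂ c₁₂ e₀₁ e₀₂ e₁₂ δ 1 ++ l) c₀₁ = false ∧
    firstOver (omegaThreeStrand c₀₁ c₀₂ c₁₂ e₀₁ e₀₂ e₁₂ δ 1 ++ l) c₀₂ = firstOver l c₀₂ ∧
    firstOver (omegaThreeStrand c₀₁ c₀₂ c₁₂ e₀₁ e₀₂ e₁₂ δ 1 ++ l) c₁₂ = true := by
  simp only [omegaThreeStrand, Matrix.cons_val]
  split_ifs <;> simp [firstOver_cons, h, h', h'.symm, h''.symm]

theorem firstOver_strand_two (h : c₀₁ ≠ c₀₂) (h' : c₀₁ ≠ c₁₂) (h'' : c₀₂ ≠ c₁₂) :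
    firstOver (omegaThreeStrand c₀₁ c₀₂ c₁₂ e₀₁ e₀₂ e₁₂ δ 2 ++ l) c₀₁ = firstOver l c₀₁ ∧
    firstOver (omegaThreeStrand c₀₁ c₀₂ c₁₂ e₀₁ e₀₂ e₁₂ δ 2 ++ l) c₀₂ = false ∧
    firstOver (omegaThreeStrand c₀₁ c₀₂ c₁₂ e₀₁ e₀₂ e₁₂ δ 2 ++ l) c₁₂ = false := by
  simp only [omegaThreeStrand, Matrix.cons_val]
  split_ifs <;> simp [firstOver_cons, h.symm, h'.symm, h'', h''.symm]

theorem perm_fin_three (π : Equiv.Perm (Fin 3)) :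
    (π 0 = 0 ∧ π 1 = 1 ∧ π 2 = 2) ∨ (π 0 = 0 ∧ π 1 = 2 ∧ π 2 = 1) ∨
    (π 0 = 1 ∧ π 1 = 0 ∧ π 2 = 2) ∨ (π 0 = 1 ∧ π 1 = 2 ∧ π 2 = 0) ∨
    (π 0 = 2 ∧ π 1 = 0 ∧ π 2 = 1) ∨ (π 0 = 2 ∧ π 1 = 1 ∧ π 2 = 0) := by
  revert π
  decide

/-- In the pseudolink `i (p D)`, the triangle of a third Reidemeister move takes a form that does
not depend on the heights of the strands: `a`, `b`, `c` are the crossings of the first and second,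
first and third, and second and third strand that the curve runs through. In the descending diagram
the strands lie in the order in which the curve runs through them; numbering them in this order
multiplies the orientation `δ` of the triangle by the sign `η` of `π`. -/
theorem exists_flat_triangle (h₁ : c₀₁ ≠ c₀₂) (h₂ : c₀₁ ≠ c₁₂) (h₃ : c₀₂ ≠ c₁₂)
    (e₀₁ e₀₂ e₁₂ : ℤˣ) (π : Equiv.Perm (Fin 3)) {x y z : List GaussLetter}
    (h : ∀ t ∈ x ++ y ++ z, t.chord ≠ c₀₁ ∧ t.chord ≠ c₀₂ ∧ t.chord ≠ c₁₂)
    (v : List GaussLetter) :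
    ∃ (a b c : ℕ × ℤˣ) (η : ℤˣ), [a.1, b.1, c.1].Perm [c₀₁, c₀₂, c₁₂] ∧
      ∀ (δ : ℤˣ) (φ : ℕ → Bool), φ = firstOver
        (x ++ omegaThreeStrand c₀₁ c₀₂ c₁₂ e₀₁ e₀₂ e₁₂ δ (π 0) ++
        y ++ omegaThreeStrand c₀₁ c₀₂ c₁₂ e₀₁ e₀₂ e₁₂ δ (π 1) ++
        z ++ omegaThreeStrand c₀₁ c₀₂ c₁₂ e₀₁ e₀₂ e₁₂ δ (π 2) ++ v) →
      (omegaThreeStrand c₀₁ c₀₂ c₁₂ e₀₁ e₀₂ e₁₂ δ (π 0)).map (flatLetter φ) =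
        (if a.2 * b.2 = η * δ then [a, b] else [b, a]) ∧
      (omegaThreeStrand c₀₁ c₀₂ c₁₂ e₀₁ e₀₂ e₁₂ δ (π 1)).map (flatLetter φ) =
        (if a.2 * c.2 = η * δ then [a, c] else [c, a]) ∧
      (omegaThreeStrand c₀₁ c₀₂ c₁₂ e₀₁ e₀₂ e₁₂ δ (π 2)).map (flatLetter φ) =
        (if b.2 * c.2 = η * δ then [b, c] else [c, b]) := by
  have hx : ∀ c, c = c₀₁ ∨ c = c₀₂ ∨ c = c₁₂ → ∀ l, firstOver (x ++ l) c = firstOver l c := by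
    rintro c hc l
    refine firstOver_append_of_forall_ne fun t ht => ?_
    have := h t (by simp [ht])
    rcases hc with rfl | rfl | rfl
    exacts [this.1, this.2.1, this.2.2]
  have hy : ∀ c, c = c₀₁ ∨ c = c₀₂ ∨ c = c₁₂ → ∀ l, firstOver (y ++ l) c = firstOver l c := by
    rintro c hc l
    refine firstOver_append_of_forall_ne fun t ht => ?_
    have := h t (by simp [ht])
    rcases hc with rfl | rfl | rfl
    exacts [this.1, this.2.1, this.2.2]
  have s₀ := fun δ l => firstOver_strand_zero (e₀₁ := e₀₁) (e₀₂ := e₀₂) (e₁₂ := e₁₂) (δ := δ)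
    (l := l) h₁ h₂ h₃
  have s₁ := fun δ l => firstOver_strand_one (e₀₁ := e₀₁) (e₀₂ := e₀₂) (e₁₂ := e₁₂) (δ := δ)
    (l := l) h₁ h₂ h₃
  have s₂ := fun δ l => firstOver_strand_two (e₀₁ := e₀₁) (e₀₂ := e₀₂) (e₁₂ := e₁₂) (δ := δ)
    (l := l) h₁ h₂ h₃
  have hneg : ¬(-1 : ℤˣ) = 1 := by decide
  have hneg' : ¬(1 : ℤˣ) = -1 := by decide
  rcases perm_fin_three π with ⟨p₀, p₁, p₂⟩ | ⟨p₀, p₁, p₂⟩ | ⟨p₀, p₁, p₂⟩ | ⟨p₀, p₁, p₂⟩ |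
    ⟨p₀, p₁, p₂⟩ | ⟨p₀, p₁, p₂⟩ <;> rw [p₀, p₁, p₂]
  on_goal 1 =>
    refine ⟨(c₀₁, e₀₁), (c₀₂, e₀₂), (c₁₂, e₁₂), 1, by grind, fun δ φ hφ => ?_⟩
    have f : φ c₀₁ = true ∧ φ c₀₂ = true ∧ φ c₁₂ = true := by
      simp [hφ, hx, hy, s₀, s₁]
  on_goal 2 =>
    refine ⟨(c₀₂, e₀₂), (c₀₁, e₀₁), (c₁₂, -e₁₂), -1, by grind, fun δ φ hφ => ?_⟩
    have f : φ c₀₁ = true ∧ φ c₀₂ = true ∧ φ c₁₂ = false := by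
      simp [hφ, hx, hy, s₀, s₂]
  on_goal 3 =>
    refine ⟨(c₀₁, -e₀₁), (c₁₂, e₁₂), (c₀₂, e₀₂), -1, by grind, fun δ φ hφ => ?_⟩
    have f : φ c₀₁ = false ∧ φ c₀₂ = true ∧ φ c₁₂ = true := by
      simp [hφ, hx, hy, s₀, s₁]
  on_goal 4 =>
    refine ⟨(c₁₂, e₁₂), (c₀₁, -e₀₁), (c₀₂, -e₀₂), 1, by grind, fun δ φ hφ => ?_⟩
    have f : φ c₀₁ = false ∧ φ c₀₂ = false ∧ φ c₁₂ = true := by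
      simp [hφ, hx, hy, s₁, s₂]
  on_goal 5 =>
    refine ⟨(c₀₂, -e₀₂), (c₁₂, -e₁₂), (c₀₁, e₀₁), 1, by grind, fun δ φ hφ => ?_⟩
    have f : φ c₀₁ = true ∧ φ c₀₂ = false ∧ φ c₁₂ = false := by
      simp [hφ, hx, hy, s₀, s₂]
  on_goal 6 =>
    refine ⟨(c₁₂, -e₁₂), (c₀₂, -e₀₂), (c₀₁, -e₀₁), -1, by grind, fun δ φ hφ => ?_⟩
    have f : φ c₀₁ = false ∧ φ c₀₂ = false ∧ φ c₁₂ = false := by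
      simp [hφ, hx, hy, s₁, s₂]
  all_goals
    obtain ⟨f₀₁, f₀₂, f₁₂⟩ := f
    clear hφ s₀ s₁ s₂ hx hy
    simp only [omegaThreeStrand, Matrix.cons_val, apply_ite (List.map (flatLetter φ)),
      List.map_cons, List.map_nil, flatLetter, f₀₁, f₀₂, f₁₂, if_true, if_false,
      Bool.false_eq_true, one_mul]
    rcases Int.units_eq_one_or e₀₁ with rfl | rfl <;>
      rcases Int.units_eq_one_or e₀₂ with rfl | rfl <;>
      rcases Int.units_eq_one_or e₁₂ with rfl | rfl <;>
      rcases Int.units_eq_one_or δ with rfl | rfl <;> simp [hneg, hneg']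

theorem chord_of_mem_omegaThreeStrand {i : Fin 3} {t : GaussLetter}
    (ht : t ∈ omegaThreeStrand c₀₁ c₀₂ c₁₂ e₀₁ e₀₂ e₁₂ δ i) :
    t.chord = c₀₁ ∨ t.chord = c₀₂ ∨ t.chord = c₁₂ := by
  fin_cases i <;> simp only [omegaThreeStrand, Fin.zero_eta, Fin.mk_one, Fin.reduceFinMk,
    Matrix.cons_val] at ht <;> split_ifs at ht <;> simp at ht <;> rcases ht with rfl | rfl <;> simp

theorem count_omegaThreeStrand (π : Equiv.Perm (Fin 3)) (t : ℕ) :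
    ((omegaThreeStrand c₀₁ c₀₂ c₁₂ e₀₁ e₀₂ e₁₂ δ (π 0)).map GaussLetter.chord).count t +
    ((omegaThreeStrand c₀₁ c₀₂ c₁₂ e₀₁ e₀₂ e₁₂ δ (π 1)).map GaussLetter.chord).count t +
    ((omegaThreeStrand c₀₁ c₀₂ c₁₂ e₀₁ e₀₂ e₁₂ δ (π 2)).map GaussLetter.chord).count t =
      2 * ((if c₀₁ = t then 1 else 0) + (if c₀₂ = t then 1 else 0) +
        if c₁₂ = t then 1 else 0) := by
  have h := Equiv.sum_comp π fun i =>
    ((omegaThreeStrand c₀₁ c₀₂ c₁₂ e₀₁ e₀₂ e₁₂ δ i).map GaussLetter.chord).count t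
  rw [Fin.sum_univ_three, Fin.sum_univ_three] at h
  rw [h]
  have hpair : ∀ (P : Prop) [Decidable P] (r s : GaussLetter),
      ((if P then [r, s] else [s, r]).map GaussLetter.chord).count t =
        (if r.chord = t then 1 else 0) + if s.chord = t then 1 else 0 := by
    intro P _ r s
    split_ifs <;> simp_all
  simp only [omegaThreeStrand, Matrix.cons_val, hpair]
  ring

theorem firstOver_append_three_blocks {x y z v l₀ l₁ l₂ : List GaussLetter} {t : ℕ}
    (h₀ : ∀ s ∈ l₀, s.chord ≠ t) (h₁ : ∀ s ∈ l₁, s.chord ≠ t) (h₂ : ∀ s ∈ l₂, s.chord ≠ t) :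
    firstOver (x ++ l₀ ++ y ++ l₁ ++ z ++ l₂ ++ v) t = firstOver (x ++ y ++ z ++ v) t := by
  rw [firstOver_append_append_of_forall_ne h₂, List.append_assoc _ z,
    firstOver_append_append_of_forall_ne h₁, List.append_assoc _ y,
    firstOver_append_append_of_forall_ne h₀]
  simp only [List.append_assoc]

end Triangle

/-! ### Invariance under the moves -/

open LongPseudolinkDiagram

theorem flatWord_relabel (w : List GaussLetter) {f : ℕ → ℕ} (hf : Function.Injective f) :
    flatWord (w.map (GaussLetter.relabel f)) = (flatWord w).map fun a => (f a.1, a.2) := by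
  have h : ∀ c, firstOver (w.map (GaussLetter.relabel f)) (f c) = firstOver w c := by
    intro c
    have : ((fun x : GaussLetter => decide (x.chord = f c)) ∘ GaussLetter.relabel f) =
        fun x => decide (x.chord = c) := by
      funext x
      simp [GaussLetter.relabel, hf.eq_iff]
    rw [firstOver, List.find?_map, this, firstOver]
    cases w.find? (fun x => decide (x.chord = c)) <;> rfl
  simp only [flatWord, List.map_map]
  refine List.map_congr_left fun x _ => ?_
  have hx := h x.chord
  simp only [Function.comp_apply, flatLetter]
  change (f x.chord, if firstOver (w.map (GaussLetter.relabel f)) (f x.chord) then x.sign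
    else -x.sign) = _
  rw [hx]

theorem writhe_eq (P : LongPseudolinkDiagram) : P.writhe = ∑ a ∈ P.word.toFinset, (a.2 : ℤ) := rfl

theorem jones_eq_of_relabel {D D' : LongGaussDiagram} (f : Equiv.Perm ℕ)
    (h : D'.word = D.word.map (GaussLetter.relabel f)) :
    jones (OpenFlatDiagram.i D.p) = jones (OpenFlatDiagram.i D'.p) := by
  have hword : (OpenFlatDiagram.i D'.p).word =
      (OpenFlatDiagram.i D.p).word.map fun a => (f a.1, a.2) := by
    rw [word_i_p, word_i_p, h, flatWord_relabel _ f.injective]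
  refine jones_eq_of ?_ ?_
  · have hF : Function.Injective fun a : ℕ × ℤˣ => (f a.1, a.2) := by
      rintro ⟨a, s⟩ ⟨b, t⟩ hab
      simp only [Prod.mk.injEq] at hab
      exact Prod.ext (f.injective hab.1) hab.2
    have himage : (OpenFlatDiagram.i D'.p).word.toFinset =
        (OpenFlatDiagram.i D.p).word.toFinset.image fun a => (f a.1, a.2) := by
      ext b
      simp [hword]
    rw [writhe_eq, writhe_eq, himage, Finset.sum_image fun _ _ _ _ hab => hF hab]
  · rw [hword, wordState_map _ _ _ _ f.injective]

theorem jones_eq_of_omegaOne {D D' : LongGaussDiagram} {x y : List GaussLetter} {c : ℕ} {o : Bool}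
    {s : ℤˣ} (h : D.word = x ++ y) (h' : D'.word = x ++ [⟨c, o, s⟩, ⟨c, !o, s⟩] ++ y) :
    jones (OpenFlatDiagram.i D.p) = jones (OpenFlatDiagram.i D'.p) := by
  have hcount := D'.count_two ⟨c, o, s⟩ (by rw [h']; simp)
  rw [h'] at hcount
  simp only [List.map_append, List.map_cons, List.map_nil, List.count_append, List.count_cons_self,
    List.count_nil] at hcount
  have hx := forall_chord_ne_of_count (u := x) (c := c) (by omega)
  have hy := forall_chord_ne_of_count (u := y) (c := c) (by omega)
  set φ := firstOver D'.word with hφ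
  have hφ' : ∀ t, t ≠ c → firstOver D.word t = φ t := by
    intro t ht
    rw [hφ, h, h', firstOver_append_append_of_forall_ne]
    simp [ht.symm]
  set a := flatLetter φ ⟨c, o, s⟩ with ha
  have hw : (OpenFlatDiagram.i D.p).word = x.map (flatLetter φ) ++ y.map (flatLetter φ) := by
    rw [word_i_p, flatWord, map_flatLetter_congr (ψ := φ), h, List.map_append]
    intro t ht
    rw [h, List.mem_append] at ht
    exact hφ' _ (ht.elim (hx t) (hy t))
  have hw' : (OpenFlatDiagram.i D'.p).word =
      x.map (flatLetter φ) ++ [a, a] ++ y.map (flatLetter φ) := by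
    rw [word_i_p, flatWord, ← hφ, h', List.map_append, List.map_append]
    rfl
  have hax : a ∉ x.map (flatLetter φ) := notMem_map_flatLetter hx
  have hay : a ∉ y.map (flatLetter φ) := notMem_map_flatLetter hy
  refine jones_eq_of_kink (s := a.2) ?_ ?_
  · have hT : (OpenFlatDiagram.i D'.p).word.toFinset =
        insert a (OpenFlatDiagram.i D.p).word.toFinset := by
      ext b
      simp [hw, hw']
    rw [writhe_eq, writhe_eq, hT, Finset.sum_insert (by simp [hw, hax, hay]), add_comm]
  · rw [hw, hw', wordState_kink powA_mul_powA_neg circleValue_eq hax hay]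
    rcases Int.units_eq_one_or a.2 with hs | hs <;> simp [hs]

theorem jones_eq_of_omegaTwo {D D' : LongGaussDiagram} {x y z : List GaussLetter} {c d : ℕ}
    {o : Bool} {s : ℤˣ} {l : List GaussLetter} (h : D.word = x ++ y ++ z)
    (h' : D'.word = x ++ [⟨c, o, s⟩, ⟨d, o, -s⟩] ++ y ++ l ++ z)
    (hl : l = [⟨c, !o, s⟩, ⟨d, !o, -s⟩] ∨ l = [⟨d, !o, -s⟩, ⟨c, !o, s⟩]) :
    jones (OpenFlatDiagram.i D.p) = jones (OpenFlatDiagram.i D'.p) := by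
  have hcount := D'.count_two ⟨c, o, s⟩ (by rw [h']; simp)
  have hcount' := D'.count_two ⟨d, o, -s⟩ (by rw [h']; simp)
  rw [h'] at hcount hcount'
  simp only [List.map_append, List.map_cons, List.map_nil, List.count_append, List.count_cons,
    List.count_nil, beq_self_eq_true, if_true] at hcount hcount'
  have hlc : (l.map GaussLetter.chord).count c = 1 + if d = c then 1 else 0 := by
    rcases hl with rfl | rfl <;> simp [List.count_cons] <;> omega
  have hld : (l.map GaussLetter.chord).count d = 1 + if c = d then 1 else 0 := by
    rcases hl with rfl | rfl <;> simp [List.count_cons] <;> omega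
  rw [hlc] at hcount
  rw [hld] at hcount'
  simp only [beq_iff_eq] at hcount hcount'
  have hdc : d ≠ c := by
    intro hdc
    simp only [hdc, if_true] at hcount
    omega
  simp only [hdc, hdc.symm, if_false] at hcount hcount'
  have hc : ∀ t ∈ x ++ y ++ z, t.chord ≠ c :=
    forall_chord_ne_of_count (by simp only [List.map_append, List.count_append]; omega)
  have hd : ∀ t ∈ x ++ y ++ z, t.chord ≠ d :=
    forall_chord_ne_of_count (by simp only [List.map_append, List.count_append]; omega)
  set φ := firstOver D'.word with hφ
  have hφ' : ∀ t, t ≠ c → t ≠ d → firstOver D.word t = φ t := by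
    intro t htc htd
    rw [hφ, h, h', firstOver_append_append_of_forall_ne (b := l), List.append_assoc _ y,
      List.append_assoc _ y, firstOver_append_append_of_forall_ne]
    · simp [htc.symm, htd.symm]
    · rcases hl with rfl | rfl <;> simp [htc.symm, htd.symm]
  have hxc : ∀ t ∈ x, t.chord ≠ c := fun t ht => hc t (by simp [ht])
  have hxd : ∀ t ∈ x, t.chord ≠ d := fun t ht => hd t (by simp [ht])
  have hφc : φ c = o := by
    rw [hφ, h', List.append_assoc, List.append_assoc, List.append_assoc,
      firstOver_append_of_forall_ne hxc]
    simp [firstOver_cons]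
  have hφd : φ d = o := by
    rw [hφ, h', List.append_assoc, List.append_assoc, List.append_assoc,
      firstOver_append_of_forall_ne hxd]
    simp [firstOver_cons]
  obtain ⟨a, ha⟩ : ∃ a : ℕ × ℤˣ, a = (c, if o then s else -s) := ⟨_, rfl⟩
  obtain ⟨b, hb⟩ : ∃ b : ℕ × ℤˣ, b = (d, if o then -s else s) := ⟨_, rfl⟩
  have hab : a.2 = -b.2 := by
    rw [ha, hb]
    cases o <;> simp
  have hw : (OpenFlatDiagram.i D.p).word =
      x.map (flatLetter φ) ++ y.map (flatLetter φ) ++ z.map (flatLetter φ) := by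
    rw [word_i_p, flatWord, map_flatLetter_congr (ψ := φ), h, List.map_append, List.map_append]
    intro t ht
    rw [h] at ht
    exact hφ' _ (hc t ht) (hd t ht)
  obtain ⟨p, q, hpq, hw'⟩ : ∃ p q, ((p = a ∧ q = b) ∨ (p = b ∧ q = a)) ∧
      (OpenFlatDiagram.i D'.p).word = x.map (flatLetter φ) ++ [a, b] ++ y.map (flatLetter φ) ++
        [p, q] ++ z.map (flatLetter φ) := by
    rcases hl with rfl | rfl
    · refine ⟨a, b, .inl ⟨rfl, rfl⟩, ?_⟩
      rw [word_i_p, flatWord, ← hφ, h']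
      simp [flatLetter, hφc, hφd, ha, hb]
    · refine ⟨b, a, .inr ⟨rfl, rfl⟩, ?_⟩
      rw [word_i_p, flatWord, ← hφ, h']
      simp [flatLetter, hφc, hφd, ha, hb]
  have haw : a ∉ x.map (flatLetter φ) ++ y.map (flatLetter φ) ++ z.map (flatLetter φ) := by
    rw [← List.map_append, ← List.map_append]
    exact notMem_map_flatLetter (by rw [ha]; exact hc)
  have hbw : b ∉ x.map (flatLetter φ) ++ y.map (flatLetter φ) ++ z.map (flatLetter φ) := by
    rw [← List.map_append, ← List.map_append]
    exact notMem_map_flatLetter (by rw [hb]; exact hd)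
  have hne : a ≠ b := by
    rw [ha, hb]
    intro hab
    exact hdc (Prod.ext_iff.1 hab).1.symm
  refine jones_eq_of ?_ ?_
  · have hT : (OpenFlatDiagram.i D'.p).word.toFinset =
        insert a (insert b (OpenFlatDiagram.i D.p).word.toFinset) := by
      rcases hpq with ⟨rfl, rfl⟩ | ⟨rfl, rfl⟩ <;> rw [hw, hw'] <;> ext t <;>
        simp only [List.mem_toFinset, List.mem_append, Finset.mem_insert, List.mem_cons,
          List.not_mem_nil] <;> tauto
    rw [← hw] at haw hbw
    rw [writhe_eq, writhe_eq, hT, Finset.sum_insert (by simp [hne, haw]),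
      Finset.sum_insert (by simp [hbw]), hab]
    simp
  · rw [hw, hw', wordState_bigon powA_mul_powA_neg circleValue_eq circleValue_ne_zero hab hpq haw
      hbw]

theorem jones_eq_of_omegaThree {D D' : LongGaussDiagram} {x y z v : List GaussLetter}
    {c₀₁ c₀₂ c₁₂ : ℕ} {e₀₁ e₀₂ e₁₂ δ : ℤˣ} {π : Equiv.Perm (Fin 3)}
    (h : D.word = x ++ omegaThreeStrand c₀₁ c₀₂ c₁₂ e₀₁ e₀₂ e₁₂ δ (π 0) ++
      y ++ omegaThreeStrand c₀₁ c₀₂ c₁₂ e₀₁ e₀₂ e₁₂ δ (π 1) ++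
      z ++ omegaThreeStrand c₀₁ c₀₂ c₁₂ e₀₁ e₀₂ e₁₂ δ (π 2) ++ v)
    (h' : D'.word = x ++ omegaThreeStrand c₀₁ c₀₂ c₁₂ e₀₁ e₀₂ e₁₂ (-δ) (π 0) ++
      y ++ omegaThreeStrand c₀₁ c₀₂ c₁₂ e₀₁ e₀₂ e₁₂ (-δ) (π 1) ++
      z ++ omegaThreeStrand c₀₁ c₀₂ c₁₂ e₀₁ e₀₂ e₁₂ (-δ) (π 2) ++ v) :
    jones (OpenFlatDiagram.i D.p) = jones (OpenFlatDiagram.i D'.p) := by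
  -- As every chord has exactly two ends, the three chords differ and do not occur elsewhere.
  have key : ∀ t, (t = c₀₁ ∨ t = c₀₂ ∨ t = c₁₂) →
      ((x ++ y ++ z ++ v).map GaussLetter.chord).count t = 0 ∧
      (if c₀₁ = t then 1 else 0) + (if c₀₂ = t then 1 else 0) + (if c₁₂ = t then 1 else 0) = 1 := by
    intro t ht
    have hcount : (D.word.map GaussLetter.chord).count t =
        ((x ++ y ++ z ++ v).map GaussLetter.chord).count t +
        2 * ((if c₀₁ = t then 1 else 0) + (if c₀₂ = t then 1 else 0) +
          if c₁₂ = t then 1 else 0) := by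
      rw [h, ← count_omegaThreeStrand (e₀₁ := e₀₁) (e₀₂ := e₀₂) (e₁₂ := e₁₂) (δ := δ) π]
      simp only [List.map_append, List.count_append]
      ring
    have hpos : 1 ≤ (if c₀₁ = t then 1 else 0) + (if c₀₂ = t then 1 else 0) +
        if c₁₂ = t then 1 else 0 := by
      rcases ht with rfl | rfl | rfl <;> simp <;> omega
    have hmem : t ∈ D.word.map GaussLetter.chord := List.count_pos_iff.1 (by omega)
    obtain ⟨s, hs, rfl⟩ := List.mem_map.1 hmem
    have := D.count_two s hs
    omega
  have k₀₁ := (key c₀₁ (by simp)).2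
  have k₀₂ := (key c₀₂ (by simp)).2
  have h₁ : c₀₁ ≠ c₀₂ := by
    rintro rfl
    rw [if_pos rfl] at k₀₁
    split_ifs at k₀₁ <;> omega
  have h₂ : c₀₁ ≠ c₁₂ := by
    rintro rfl
    rw [if_pos rfl] at k₀₁
    split_ifs at k₀₁ <;> omega
  have h₃ : c₀₂ ≠ c₁₂ := by
    rintro rfl
    rw [if_pos rfl] at k₀₂
    split_ifs at k₀₂ <;> omega
  have hout : ∀ s ∈ x ++ y ++ z ++ v, s.chord ≠ c₀₁ ∧ s.chord ≠ c₀₂ ∧ s.chord ≠ c₁₂ := fun s hs =>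
    ⟨forall_chord_ne_of_count (key c₀₁ (by simp)).1 s hs,
      forall_chord_ne_of_count (key c₀₂ (by simp)).1 s hs,
      forall_chord_ne_of_count (key c₁₂ (by simp)).1 s hs⟩
  obtain ⟨a, b, c, η, hperm, hflat⟩ := exists_flat_triangle h₁ h₂ h₃ e₀₁ e₀₂ e₁₂ π
    (fun s hs => hout s (List.mem_append_left _ hs)) v
  obtain ⟨f₀, f₁, f₂⟩ := hflat δ _ rfl
  obtain ⟨f₀', f₁', f₂'⟩ := hflat (-δ) _ rfl
  rw [← h] at f₀ f₁ f₂
  rw [← h'] at f₀' f₁' f₂'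
  have hφ : ∀ s ∈ x ++ y ++ z ++ v, firstOver D'.word s.chord = firstOver D.word s.chord := by
    intro s hs
    have hne : ∀ (δ : ℤˣ) (i : Fin 3), ∀ r ∈ omegaThreeStrand c₀₁ c₀₂ c₁₂ e₀₁ e₀₂ e₁₂ δ i,
        r.chord ≠ s.chord := by
      intro δ i r hr hrs
      have := hout s hs
      rcases chord_of_mem_omegaThreeStrand hr with hr | hr | hr <;> simp_all
    rw [h, h', firstOver_append_three_blocks (hne _ _) (hne _ _) (hne _ _),
      firstOver_append_three_blocks (hne _ _) (hne _ _) (hne _ _)]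
  set φ := firstOver D.word
  have hw : (OpenFlatDiagram.i D.p).word = x.map (flatLetter φ) ++
      (if a.2 * b.2 = η * δ then [a, b] else [b, a]) ++ y.map (flatLetter φ) ++
      (if a.2 * c.2 = η * δ then [a, c] else [c, a]) ++ z.map (flatLetter φ) ++
      (if b.2 * c.2 = η * δ then [b, c] else [c, b]) ++ v.map (flatLetter φ) := by
    rw [word_i_p, ← f₀, ← f₁, ← f₂]
    simp only [flatWord, ← List.map_append, ← h]
    rfl
  have hw' : (OpenFlatDiagram.i D'.p).word = x.map (flatLetter φ) ++
      (if a.2 * b.2 = -(η * δ) then [a, b] else [b, a]) ++ y.map (flatLetter φ) ++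
      (if a.2 * c.2 = -(η * δ) then [a, c] else [c, a]) ++ z.map (flatLetter φ) ++
      (if b.2 * c.2 = -(η * δ) then [b, c] else [c, b]) ++ v.map (flatLetter φ) := by
    rw [word_i_p, ← mul_neg, ← f₀', ← f₁', ← f₂',
      ← map_flatLetter_congr (u := x) (fun s hs => hφ s (by simp [hs])),
      ← map_flatLetter_congr (u := y) (fun s hs => hφ s (by simp [hs])),
      ← map_flatLetter_congr (u := z) (fun s hs => hφ s (by simp [hs])),
      ← map_flatLetter_congr (u := v) (fun s hs => hφ s (by simp [hs]))]
    simp only [flatWord, ← List.map_append, ← h']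
  have hnodup : [a.1, b.1, c.1].Nodup := hperm.nodup_iff.2 (by simp [h₁, h₂, h₃])
  simp only [List.nodup_cons, List.mem_cons, List.not_mem_nil, or_false, not_or] at hnodup
  have hab : a ≠ b := fun h => hnodup.1.1 (congrArg Prod.fst h)
  have hac : a ≠ c := fun h => hnodup.1.2 (congrArg Prod.fst h)
  have hbc : b ≠ c := fun h => hnodup.2.1 (congrArg Prod.fst h)
  have hnotMem : ∀ r : ℕ × ℤˣ, r.1 ∈ [a.1, b.1, c.1] → r ∉ x.map (flatLetter φ) ++
      y.map (flatLetter φ) ++ z.map (flatLetter φ) ++ v.map (flatLetter φ) := by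
    intro r hr
    rw [← List.map_append, ← List.map_append, ← List.map_append]
    refine notMem_map_flatLetter fun s hs hsr => ?_
    have hr' := hperm.mem_iff.1 hr
    have := hout s hs
    simp only [List.mem_cons, List.not_mem_nil, or_false, ← hsr] at hr'
    tauto
  refine jones_eq_of ?_ ?_
  · have hpair : ∀ (P : Prop) [Decidable P] (s t : ℕ × ℤˣ),
        (if P then [s, t] else [t, s]).toFinset = {s, t} := by
      intro P _ s t
      split_ifs
      · simp
      · simp [Finset.pair_comm]
    rw [writhe_eq, writhe_eq, hw, hw']
    simp only [List.toFinset_append, hpair]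
  · exact wordState_triangle powA_mul_powA_neg circleValue_eq circleValue_ne_zero hab hac hbc
      (hnotMem a (by simp)) (hnotMem b (by simp)) (hnotMem c (by simp)) hw hw'

theorem jones_eq_of_move {D D' : LongGaussDiagram} (h : D.Move D') :
    jones (OpenFlatDiagram.i D.p) = jones (OpenFlatDiagram.i D'.p) := by
  cases h with
  | relabel f h => exact jones_eq_of_relabel f h
  | omegaOne x y c o s h h' => exact jones_eq_of_omegaOne h h'
  | omegaTwoDirect x y z c d o s h h' => exact jones_eq_of_omegaTwo h h' (.inl rfl)
  | omegaTwoOpposite x y z c d o s h h' => exact jones_eq_of_omegaTwo h h' (.inr rfl)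
  | omegaThree x y z v c₀₁ c₀₂ c₁₂ e₀₁ e₀₂ e₁₂ δ π h h' => exact jones_eq_of_omegaThree h h'

theorem theorem3p2 (K : LongVirtualKnot) (D D' : LongGaussDiagram)
    (hD : D.IsDiagramOf K) (hD' : D'.IsDiagramOf K) :
    LongPseudolinkDiagram.jones (OpenFlatDiagram.i D.p) =
      LongPseudolinkDiagram.jones (OpenFlatDiagram.i D'.p) :=
  congrArg (Quot.lift (fun D : LongGaussDiagram => jones (OpenFlatDiagram.i D.p))
    fun _ _ h => jones_eq_of_move h) (hD.trans hD'.symm)
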